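/- Let $\mathcal H$ be a complex Hilbert space and let $\pi:\mathrm U(1)\to\mathcal U(\mathcal H)$ be a strongly continuous unitary representation, $\pi(e^{i\alpha})=e^{i\alpha X}$, where $X$ is selfadjoint with spectrum consisting of integer eigenvalues. For $\mu\in\mathbb Z$ let $\mathcal H^{(\mu)}=\{\psi:\pi(z)\psi=z^{\mu}\psi\ \text{for all } z\in \mathrm U(1)\}$ be the eigenspace of $X$ for $\mu$, and $X^{(\mu)}$ the orthogonal projection onto it. Assume that every $\mathcal H^{(\mu)}$ is finite-dimensional and that $\mathcal H^{(\mu)}=0$ for $\mu<0$. Let $\mathfrak u(X)$ be the set of all $iH$ with $H$ a (possibly unbounded) selfadjoint operator on $\mathcal H$ commuting with $X$ (i.e. with all $X^{(\mu)}$). Each such $H$ is defined on all $\mathcal H^{(\mu)}$; write $H^{(\mu)}=X^{(\mu)}HX^{(\mu)}$ and $H^{[K]}=\sum_{\mu=0}^{K}H^{(\mu)}$. Let $$\mathfrak{su}(X)=\{iH\in\mathfrak u(X):\operatorname{tr}H^{(\mu)}=0\ \text{for all }\mu\},$$ $$\mathfrak{su}^{[K]}(X)=\bigoplus_{\mu=0}^{K}\mathfrak{su}(\mathcal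 H^{(\mu)}),$$ where $\mathfrak{su}(\mathcal K)$ denotes the traceless anti-selfadjoint operators on a finite-dimensional subspace $\mathcal K$, extended by $0$ to $\mathcal H$. Let $$\mathcal{SU}(X)=\{U\in\mathcal U(\mathcal H): [U,\pi(z)]=0\ \text{for all } z\in \mathrm U(1),\ \det\big(X^{(\mu)}UX^{(\mu)}|_{\mathcal H^{(\mu)}}\big)=1\ \text{for all }\mu\}.$$ Let $iH_1,\dots,iH_d\in\mathfrak{su}(X)$. Let $\mathcal G$ be the dynamical group they generate, i.e. the smallest subgroup of $\mathcal U(\mathcal H)$ that is closed in $\mathcal U(\mathcal H)$ in the strong operator topology and contains $\exp(itH_k)$ for all $k\in\{1,\dots,d\}$ and $t\in\mathbb R$. For $K\in\mathbb N=\{1,2,\dots\}$ let $\mathfrak l^{[K]}$ be the real Lie algebra of operators generated by $iH_1^{[K]},\dots,iH_d^{[K]}$ (that is, the set of truncations $Q^{[K]}$ of the elements $Q$ of the Lie algebra $\mathfrak l\subset\mathfrak u(X)$ generated by $iH_1,\dots,iH_d$). If $\mathfrak l^{[K]}=\mathfrak{su}^{[K]}(X)$ for all $K\in\mathbb N$,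 then $\mathcal G=\mathcal{SU}(X)$. -/

import Mathlib

open scoped InnerProductSpace

attribute [local instance 100] LieRing.ofAssociativeRing

noncomputable section

namespace BlockControl

variable {E : Type*} [NormedAddCommGroup E] [InnerProductSpace ℂ E] [CompleteSpace E]

/-- The charge space `ℋ^(μ)` of a unitary representation `π` of the circle group `U(1)`: the
vectors on which `π z` acts as multiplication by `z ^ μ`.  If `X` is the selfadjoint operator with
`π (exp (i α)) = exp (i α X)`, this is the eigenspace of `X` for the eigenvalue `μ`. -/
def chargeSpace (π : Circle →* unitary (E →L[ℂ] E)) (μ : ℤ) : Submodule ℂ E where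
  carrier := {ψ | ∀ z : Circle, (π z : E →L[ℂ] E) ψ = ((z : ℂ) ^ μ) • ψ}
  add_mem' := by
    intro a b ha hb z
    rw [map_add, ha z, hb z, smul_add]
  zero_mem' := by
    intro z
    rw [map_zero, smul_zero]
  smul_mem' := by
    intro c a ha z
    rw [map_smul, ha z, smul_comm]

variable (E) in
/-- A `U(1)` symmetry of the Hilbert space `E`: a strongly continuous unitary representation of the
circle group, all of whose charges have finite multiplicity and are non-negative.  It is the same
thing as its charge operator `X`, which enters through its eigenspaces only. -/
structure ChargeSymmetry where
  /-- the representation `z ↦ π(z)` -/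
  rep : Circle →* unitary (E →L[ℂ] E)
  strongly_continuous : ∀ ψ : E, Continuous fun z : Circle => (rep z : E →L[ℂ] E) ψ
  finite_multiplicity : ∀ μ : ℤ, FiniteDimensional ℂ (chargeSpace rep μ)
  nonneg_charges : ∀ μ : ℤ, μ < 0 → chargeSpace rep μ = ⊥

/-- The eigenspace `ℋ^(μ)` of the charge operator. -/
def ChargeSymmetry.space (X : ChargeSymmetry E) (μ : ℤ) : Submodule ℂ E :=
  chargeSpace X.rep μ

instance ChargeSymmetry.finiteDimensional_space (X : ChargeSymmetry E) (μ : ℤ) :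
    FiniteDimensional ℂ (X.space μ) :=
  X.finite_multiplicity μ

/-- The eigenprojection `X^(μ)`, i.e. the orthogonal projection of `E` onto `ℋ^(μ)`. -/
def ChargeSymmetry.proj (X : ChargeSymmetry E) (μ : ℤ) : E →L[ℂ] E :=
  (X.space μ).starProjection

/-! ### Selfadjoint operators commuting with the charge -/

/-- `i H ∈ 𝔲(X)`: the (possibly unbounded) operator `H` is selfadjoint and commutes with `X`, i.e.
with all the bounded operators `X^(μ)`.  A bounded operator `B` commutes with (the spectral
projections of) a selfadjoint operator `H` iff `B H ⊆ H B` as unbounded operators. -/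
structure ChargeSymmetry.MemU (X : ChargeSymmetry E) (H : E →ₗ.[ℂ] E) : Prop where
  selfAdjoint : IsSelfAdjoint H
  commutes : ∀ (μ : ℤ) (ψ : H.domain),
    ∃ h : X.proj μ ψ ∈ H.domain, H ⟨X.proj μ ψ, h⟩ = X.proj μ (H ψ)

/-- An operator commuting with `X` is defined on every charge space. -/
theorem ChargeSymmetry.MemU.space_le_domain {X : ChargeSymmetry E} {H : E →ₗ.[ℂ] E}
    (hH : X.MemU H) (μ : ℤ) : X.space μ ≤ H.domain := by
  intro ψ hψ
  have hS : IsClosed ((X.space μ ⊓ H.domain : Submodule ℂ E) : Set E) := by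
    have : FiniteDimensional ℂ (X.space μ ⊓ H.domain : Submodule ℂ E) :=
      Submodule.finiteDimensional_inf_left _ _
    exact Submodule.closed_of_finiteDimensional _
  have hmem : X.proj μ ψ ∈ closure ((X.space μ ⊓ H.domain : Submodule ℂ E) : Set E) := by
    refine map_mem_closure (X.proj μ).continuous (hH.selfAdjoint.dense_domain ψ) ?_
    intro φ hφ
    exact ⟨Submodule.starProjection_apply_mem _ φ, (hH.commutes μ ⟨φ, hφ⟩).1⟩
  rw [hS.closure_eq, ChargeSymmetry.proj, Submodule.starProjection_eq_self_iff.2 hψ] at hmem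
  exact hmem.2

/-- The block `H^(μ)`, the operator `X^(μ) H X^(μ)` on the finite-dimensional space `ℋ^(μ)`. -/
def ChargeSymmetry.block (X : ChargeSymmetry E) {H : E →ₗ.[ℂ] E} (hH : X.MemU H) (μ : ℤ) :
    X.space μ →ₗ[ℂ] X.space μ :=
  ((X.space μ).orthogonalProjectionOnto : E →ₗ[ℂ] X.space μ) ∘ₗ H.toFun ∘ₗ
    Submodule.inclusion (hH.space_le_domain μ)

/-- `i H ∈ 𝔰𝔲(X)`: the operator `i H` is in `𝔲(X)` and all blocks `H^(μ)` are traceless. -/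
structure ChargeSymmetry.MemSU (X : ChargeSymmetry E) (H : E →ₗ.[ℂ] E) : Prop where
  memU : X.MemU H
  traceless : ∀ μ : ℤ, LinearMap.trace ℂ (X.space μ) (X.block memU μ) = 0

/-- The truncation `H^[K] = ∑_{μ = 0}^K H^(μ)`, as a finite-rank operator on `E`. -/
def ChargeSymmetry.trunc (X : ChargeSymmetry E) {H : E →ₗ.[ℂ] E} (hH : X.MemU H) (K : ℕ) :
    E →L[ℂ] E :=
  ∑ μ ∈ Finset.range (K + 1),
    (X.space μ).subtypeL ∘L (LinearMap.toContinuousLinearMap (X.block hH μ)) ∘L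
      (X.space μ).orthogonalProjectionOnto

/-- The real Lie algebra `𝔩^[K]` generated by the truncations `i H_1^[K], …, i H_d^[K]`. -/
def ChargeSymmetry.truncLie (X : ChargeSymmetry E) {d : ℕ} {H : Fin d → E →ₗ.[ℂ] E}
    (hH : ∀ k, X.MemU (H k)) (K : ℕ) : LieSubalgebra ℝ (E →L[ℂ] E) :=
  LieSubalgebra.lieSpan ℝ (E →L[ℂ] E) (Set.range fun k => Complex.I • X.trunc (hH k) K)

/-- The compression of a bounded operator to a closed subspace, as an operator of that subspace. -/
def compression (V : Submodule ℂ E) [V.HasOrthogonalProjection] (A : E →L[ℂ] E) :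
    V →ₗ[ℂ] V :=
  ((V.orthogonalProjectionOnto ∘L A ∘L V.subtypeL : V →L[ℂ] V) : V →ₗ[ℂ] V)

/-- `𝔰𝔲(V)` for a finite-dimensional subspace `V`: the traceless anti-selfadjoint operators on `V`,
regarded as operators on `E` with range in `V` and vanishing on the complement of `V`. -/
def suSubspace (V : Submodule ℂ E) [V.HasOrthogonalProjection] : Set (E →L[ℂ] E) :=
  {Q | star Q = -Q ∧ V.starProjection ∘L Q = Q ∧ Q ∘L V.starProjection = Q ∧
    LinearMap.trace ℂ V (compression V Q) = 0}

/-- `𝔰𝔲^[K](X) = ⨁_{μ = 0}^K 𝔰𝔲(ℋ^(μ))`. -/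
def ChargeSymmetry.suTrunc (X : ChargeSymmetry E) (K : ℕ) : Set (E →L[ℂ] E) :=
  {Q | ∃ q : ℕ → E →L[ℂ] E, (∀ μ ≤ K, q μ ∈ suSubspace (X.space μ)) ∧
    Q = ∑ μ ∈ Finset.range (K + 1), q μ}

/-! ### Groups -/

/-- `𝒮𝒰(X)`: the unitaries that commute with the representation and all of whose blocks
`U^(μ) = X^(μ) U X^(μ)` have determinant one. -/
def ChargeSymmetry.SU (X : ChargeSymmetry E) : Set (unitary (E →L[ℂ] E)) :=
  {U | (∀ z : Circle, X.rep z * U = U * X.rep z) ∧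
    ∀ μ : ℤ, LinearMap.det (compression (X.space μ) (U : E →L[ℂ] E)) = 1}

/-- A set of unitaries is strongly closed (in the unitary group) if it contains every unitary `U`
all of whose strong neighbourhoods `{V | ‖(V - U) ψ_j‖ < ε for j = 1, …, f}` meet it. -/
def IsStronglyClosed (S : Set (unitary (E →L[ℂ] E))) : Prop :=
  ∀ U : unitary (E →L[ℂ] E),
    (∀ (F : Finset E) (ε : ℝ), 0 < ε →
      ∃ V ∈ S, ∀ ψ ∈ F, ‖((V : E →L[ℂ] E) - (U : E →L[ℂ] E)) ψ‖ < ε) → U ∈ S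

/-- `U t = exp (i t H)` for all `t`: the strongly continuous one-parameter unitary group `U` has
infinitesimal generator `i H`, domains included.  For selfadjoint `H` there is exactly one such
`U`, by Stone's theorem. -/
structure IsExpGroup (H : E →ₗ.[ℂ] E) (U : ℝ → unitary (E →L[ℂ] E)) : Prop where
  map_zero : U 0 = 1
  map_add : ∀ s t : ℝ, U (s + t) = U s * U t
  strongly_continuous : ∀ ψ : E, Continuous fun t : ℝ => (U t : E →L[ℂ] E) ψ
  generator : ∀ ψ φ : E, HasDerivAt (fun t : ℝ => (U t : E →L[ℂ] E) ψ) φ 0 ↔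
    ∃ h : ψ ∈ H.domain, φ = Complex.I • H ⟨ψ, h⟩

/-- The dynamical group of the control Hamiltonians `H_1, …, H_d`: the smallest strongly closed
subgroup of the unitary group that contains `exp (i t H_k)` for all `k` and all real `t`. -/
def dynamicalGroup {d : ℕ} (H : Fin d → E →ₗ.[ℂ] E) : Subgroup (unitary (E →L[ℂ] E)) :=
  sInf {G | IsStronglyClosed (G : Set (unitary (E →L[ℂ] E))) ∧
    ∀ (k : Fin d) (U : ℝ → unitary (E →L[ℂ] E)), IsExpGroup (H k) U → ∀ t : ℝ, U t ∈ G}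

end BlockControl

end

namespace BlockControl

open Filter Topology NormedSpace

/-! ### Exponentials in Banach algebras -/

section ExpGeneral

/-! Everything is block diagonal over the finite-dimensional charge spaces. These are mutually
orthogonal and have dense span (`ChargeSymmetry.eq_zero_of_orthogonal`, a Fourier argument), so the
finite-rank projections P_K onto the charges at most K converge strongly to the identity. This
reduces unbounded operators to matrices: exp (itH) exists and acts on each block as the matrix
exponential of the block (`ChargeSymmetry.MemU.exists_isExpGroup`,
`ChargeSymmetry.MemU.eq_truncExp_of_isExpGroup`).

The dynamical group 𝒢 is contained in 𝒮𝒰(X), because 𝒮𝒰(X) is a strongly closed subgroup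
(`ChargeSymmetry.isStronglyClosed_SU`) and det exp (itH^(μ)) = exp (it tr H^(μ)) = 1.

Conversely, let U be in 𝒮𝒰(X). A strong neighbourhood of U tests finitely many vectors, so up to a
small error it sees only the charges at most some K. The restrictions of 𝒢 to these charges form a
bounded monoid, and the directions whose one-parameter groups stay in its norm closure form a Lie
algebra (`lieOfMonoid`). It contains every iH_k^[K], hence 𝔩^[K] = 𝔰𝔲^[K](X). Each block of U has
determinant one, so it is the exponential of a traceless anti-selfadjoint matrix
(`exists_traceless_exp_eq`). Thus U agrees on these charges with an element of the closure, and some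
element of 𝒢 approximates it there. -/

/-- The relation passes to powers and then termwise through the exponential series. With L an
eigenvector, the inclusion of a block or a cutoff, this computes all exponentials on invariant
subspaces. -/
theorem exp_comp_eq_comp_exp {E F : Type*} [NormedAddCommGroup E] [NormedSpace ℂ E]
    [CompleteSpace E] [NormedAddCommGroup F] [NormedSpace ℂ F] [CompleteSpace F]
    {A : E →L[ℂ] E} {B : F →L[ℂ] F} {L : F →L[ℂ] E} (h : A ∘L L = L ∘L B) :
    exp A ∘L L = L ∘L exp B := by
  have hpow : ∀ n : ℕ, (A ^ n) ∘L L = L ∘L (B ^ n) := by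
    intro n
    induction n with
    | zero => ext; simp
    | succ n ih =>
      calc (A ^ (n + 1)) ∘L L = (A ^ n) ∘L (A ∘L L) := by rw [pow_succ]; rfl
        _ = ((A ^ n) ∘L L) ∘L B := by rw [h]; rfl
        _ = L ∘L (B ^ (n + 1)) := by rw [ih, pow_succ]; rfl
  have hA := exp_series_hasSum_exp' (𝕂 := ℂ) A
  have hB := exp_series_hasSum_exp' (𝕂 := ℂ) B
  have hA' := hA.mapL ((ContinuousLinearMap.compL ℂ F E E).flip L)
  have hB' := hB.mapL (ContinuousLinearMap.compL ℂ F F E L)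
  have heq : ∀ n : ℕ, (ContinuousLinearMap.compL ℂ F E E).flip L ((n.factorial : ℂ)⁻¹ • A ^ n) =
      ContinuousLinearMap.compL ℂ F F E L ((n.factorial : ℂ)⁻¹ • B ^ n) := by
    intro n
    rw [map_smul, map_smul]
    exact congrArg _ (hpow n)
  simp only [heq] at hA'
  exact hA'.unique hB'

theorem exp_smul_one_clm (c : ℂ) :
    exp (c • (1 : ℂ →L[ℂ] ℂ)) = (Complex.exp c) • (1 : ℂ →L[ℂ] ℂ) := by
  have := algebraMap_exp_comm_of_mem_ball (𝕂 := ℂ) (𝔸 := ℂ →L[ℂ] ℂ) c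
    (by simp [expSeries_radius_eq_top])
  rw [Algebra.algebraMap_eq_smul_one, Algebra.algebraMap_eq_smul_one] at this
  rw [← this, Complex.exp_eq_exp_ℂ]

theorem exp_apply_of_apply_eq_smul {E : Type*} [NormedAddCommGroup E] [NormedSpace ℂ E]
    [CompleteSpace E] {A : E →L[ℂ] E} {v : E} {c : ℂ} (h : A v = c • v) :
    exp A v = Complex.exp c • v := by
  have key := exp_comp_eq_comp_exp (A := A) (B := c • (1 : ℂ →L[ℂ] ℂ))
    (L := (ContinuousLinearMap.toSpanSingleton ℂ v)) (by ext; simp [h])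
  have := DFunLike.congr_fun key 1
  simpa [exp_smul_one_clm] using this

theorem pow_sub_pow_eq_sum {𝔸 : Type*} [Ring 𝔸] (x y : 𝔸) (n : ℕ) :
    x ^ n - y ^ n = ∑ i ∈ Finset.range n, x ^ i * (x - y) * y ^ (n - 1 - i) := by
  induction n with
  | zero => simp
  | succ n ih =>
    rw [Finset.sum_range_succ]
    have : ∑ i ∈ Finset.range n, x ^ i * (x - y) * y ^ (n + 1 - 1 - i) =
        (x ^ n - y ^ n) * y := by
      rw [ih, Finset.sum_mul]
      refine Finset.sum_congr rfl fun i hi => ?_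
      have : n + 1 - 1 - i = (n - 1 - i) + 1 := by
        have := Finset.mem_range.1 hi; omega
      rw [this, pow_succ, mul_assoc _ (y ^ _) y]
    rw [this]
    simp only [add_tsub_cancel_right, tsub_self, pow_zero, mul_one, pow_succ, sub_mul, mul_sub]
    abel

/-- Telescoping with bounds on the powers instead of on x and y themselves: the factors need not be
contractions, and the loss is still only linear in n. -/
theorem norm_pow_sub_pow_le {𝔸 : Type*} [NormedRing 𝔸] {x y : 𝔸} {M N : ℝ} {n : ℕ}
    (hx : ∀ k ≤ n, ‖x ^ k‖ ≤ M)
    (hy : ∀ k ≤ n, ‖y ^ k‖ ≤ N) : ‖x ^ n - y ^ n‖ ≤ n * (M * ‖x - y‖ * N) := by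
  have hM : 0 ≤ M := (norm_nonneg _).trans (hx 0 (Nat.zero_le _))
  rw [pow_sub_pow_eq_sum]
  refine (norm_sum_le _ _).trans ?_
  have : ∀ i ∈ Finset.range n, ‖x ^ i * (x - y) * y ^ (n - 1 - i)‖ ≤ M * ‖x - y‖ * N := by
    intro i hi
    have := Finset.mem_range.1 hi
    refine (norm_mul_le _ _).trans ?_
    refine mul_le_mul ((norm_mul_le _ _).trans ?_) (hy _ (by omega)) (norm_nonneg _) (by positivity)
    gcongr
    exact hx _ (by omega)
  simpa using Finset.sum_le_card_nsmul _ _ _ this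

variable {𝔸 : Type*} [NormedRing 𝔸] [NormedAlgebra ℝ 𝔸] [CompleteSpace 𝔸]

theorem exp_smul_pow (A : 𝔸) (s : ℝ) (k : ℕ) : exp (s • A) ^ k = exp ((k * s) • A) := by
  let +nondep : NormedAlgebra ℚ 𝔸 := .restrictScalars ℚ ℝ 𝔸
  rw [← exp_nsmul, ← Nat.cast_smul_eq_nsmul ℝ, smul_smul]

theorem continuous_exp_smul (A : 𝔸) : Continuous fun s : ℝ => exp (s • A) := by
  let +nondep : NormedAlgebra ℚ 𝔸 := .restrictScalars ℚ ℝ 𝔸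
  exact exp_continuous.comp (continuous_id.smul continuous_const)

/-- Lie's product formula, when the powers of the factors stay bounded. -/
theorem tendsto_exp_mul_exp_pow {A B : 𝔸} {M : ℝ}
    (hM : ∀ (s : ℝ) (k : ℕ), ‖(exp (s • A) * exp (s • B)) ^ k‖ ≤ M) :
    Tendsto (fun n : ℕ => (exp ((1 / (n + 1 : ℝ)) • A) * exp ((1 / (n + 1 : ℝ)) • B)) ^ (n + 1))
      atTop (𝓝 (exp (A + B))) := by
  -- The two curves agree to first order at 0, so each of the n + 1 telescoped terms is o(1 / n).
  have hf : HasDerivAt (fun s : ℝ => exp (s • A) * exp (s • B) - exp (s • (A + B))) 0 0 := by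
    have h1 := hasDerivAt_exp_smul_const (𝕂 := ℝ) A 0
    have h2 := hasDerivAt_exp_smul_const (𝕂 := ℝ) B 0
    have h3 := hasDerivAt_exp_smul_const (𝕂 := ℝ) (A + B) 0
    have h := (h1.mul h2).sub h3
    simp only [zero_smul, exp_zero, one_mul, mul_one, sub_self] at h
    exact h
  obtain ⟨N, hN⟩ := (isCompact_Icc (a := (0 : ℝ)) (b := 1)).exists_bound_of_continuousOn
    (continuous_exp_smul (A + B)).continuousOn
  rw [tendsto_iff_norm_sub_tendsto_zero]
  have hs : Tendsto (fun n : ℕ => (1 / (n + 1 : ℝ))) atTop (𝓝[≠] 0) :=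
    tendsto_nhdsWithin_iff.2 ⟨tendsto_one_div_add_atTop_nhds_zero_nat,
      Eventually.of_forall fun n => (Nat.one_div_pos_of_nat (n := n)).ne'⟩
  have hslope := (hasDerivAt_iff_tendsto_slope_zero.1 hf).comp hs
  have hlim := (hslope.norm.const_mul (M * N))
  simp only [norm_zero, mul_zero] at hlim
  refine squeeze_zero (fun n => norm_nonneg _) (fun n => ?_) hlim
  have hn : (0 : ℝ) < n + 1 := by positivity
  have hy : exp (A + B) = exp ((1 / (n + 1 : ℝ)) • (A + B)) ^ (n + 1) := by
    rw [exp_smul_pow]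
    push_cast
    rw [mul_one_div_cancel hn.ne', one_smul]
  rw [hy]
  refine (norm_pow_sub_pow_le (M := M) (N := N) (fun k _ => hM _ k) (fun k hk => ?_)).trans ?_
  · rw [exp_smul_pow]
    refine hN _ ⟨by positivity, ?_⟩
    rw [mul_one_div, div_le_one hn]
    exact_mod_cast hk
  · simp only [Function.comp, zero_add, zero_smul, exp_zero, mul_one, sub_self, sub_zero,
      norm_smul, one_div, inv_inv]
    rw [Real.norm_of_nonneg hn.le]
    push_cast
    apply le_of_eq
    ring

theorem exp_conj_exp (A B : 𝔸) (s t : ℝ) :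
    exp (t • (exp (s • A) * B * exp ((-s) • A))) =
      exp (s • A) * exp (t • B) * exp ((-s) • A) := by
  let +nondep : NormedAlgebra ℚ 𝔸 := .restrictScalars ℚ ℝ 𝔸
  have h1 : exp (s • A) * exp ((-s) • A) = 1 := by
    rw [← exp_add_of_commute (((Commute.refl A).smul_left _).smul_right _), ← add_smul]; simp
  have h2 : exp ((-s) • A) * exp (s • A) = 1 := by
    rw [← exp_add_of_commute (((Commute.refl A).smul_left _).smul_right _), ← add_smul]; simp
  have := exp_units_conj ⟨exp (s • A), exp ((-s) • A), h1, h2⟩ (t • B)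
  simpa using this

/-- The Lie algebra of a bounded closed multiplicative submonoid of a Banach algebra. -/
def lieOfMonoid (S : Submonoid 𝔸) (hS : IsClosed (S : Set 𝔸)) (M : ℝ) (hM : ∀ x ∈ S, ‖x‖ ≤ M) :
    LieSubalgebra ℝ 𝔸 :=
  have hsmul : ∀ (c : ℝ) {a : 𝔸}, (∀ t : ℝ, exp (t • a) ∈ S) → ∀ t : ℝ, exp (t • c • a) ∈ S :=
    fun c a ha t => by rw [smul_smul]; exact ha _
  have hadd : ∀ {a b : 𝔸}, (∀ t : ℝ, exp (t • a) ∈ S) → (∀ t : ℝ, exp (t • b) ∈ S) →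
      ∀ t : ℝ, exp (t • (a + b)) ∈ S := by
    intro a b ha hb t
    rw [smul_add]
    have hmem : ∀ s : ℝ, exp (s • t • a) * exp (s • t • b) ∈ S := fun s => by
      rw [smul_smul, smul_smul]; exact S.mul_mem (ha _) (hb _)
    exact hS.mem_of_tendsto
      (tendsto_exp_mul_exp_pow (M := M) fun s k => hM _ (S.pow_mem (hmem s) k))
      (Eventually.of_forall fun n => S.pow_mem (hmem _) _)
  { carrier := {a | ∀ t : ℝ, exp (t • a) ∈ S}
    add_mem' := hadd
    zero_mem' := fun t => by simp [S.one_mem]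
    smul_mem' := fun c a ha => hsmul c ha
    lie_mem' := by
      intro a b ha hb
      have hclosed : IsClosed {a : 𝔸 | ∀ t : ℝ, exp (t • a) ∈ S} := by
        let +nondep : NormedAlgebra ℚ 𝔸 := .restrictScalars ℚ ℝ 𝔸
        simp only [Set.ofPred_forall]
        exact isClosed_iInter fun t => hS.preimage (exp_continuous.comp (continuous_const_smul t))
      have hc : ∀ s t : ℝ, exp (t • (exp (s • a) * b * exp ((-s) • a))) ∈ S := fun s t => by
        rw [exp_conj_exp]; exact S.mul_mem (S.mul_mem (ha _) (hb _)) (ha _)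
      -- The bracket is the velocity of the conjugates of b. Its difference quotients are real
      -- combinations of such conjugates, hence lie in the closed set.
      have hder : HasDerivAt (fun s : ℝ => exp (s • a) * b * exp ((-s) • a)) ⁅a, b⁆ 0 := by
        have h1 := hasDerivAt_exp_smul_const (𝕂 := ℝ) a 0
        have h2 : HasDerivAt (fun s : ℝ => exp ((-s) • a)) (-a) 0 := by
          have := (hasDerivAt_exp_smul_const (𝕂 := ℝ) a (-0)).scomp (0 : ℝ) (hasDerivAt_neg (0 : ℝ))
          simpa [Function.comp_def] using this
        have h := (h1.mul_const b).mul h2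
        simp only [zero_smul, neg_zero, exp_zero, one_mul, mul_one, mul_neg] at h
        rwa [← sub_eq_add_neg, ← LieRing.of_associative_ring_bracket] at h
      refine hclosed.mem_of_tendsto (hasDerivAt_iff_tendsto_slope_zero.1 hder)
        (Eventually.of_forall fun s => ?_)
      refine hsmul _ ?_
      rw [sub_eq_add_neg]
      refine hadd (hc _) ?_
      simpa using hsmul (-1) (hc 0) }

end ExpGeneral

/-! ### Unitary operators in finite dimension -/

section FiniteDimensional

variable {V : Type*} [NormedAddCommGroup V] [InnerProductSpace ℂ V] [FiniteDimensional ℂ V]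
  [CompleteSpace V]

theorem det_exp_I_smul {C : V →L[ℂ] V} (hC : IsSelfAdjoint C) :
    LinearMap.det ((exp (Complex.I • C) : V →L[ℂ] V) : V →ₗ[ℂ] V) =
      Complex.exp (Complex.I * LinearMap.trace ℂ V (C : V →ₗ[ℂ] V)) := by
  have hs := ContinuousLinearMap.isSelfAdjoint_iff_isSymmetric.1 hC
  let b := hs.eigenvectorBasis rfl
  have hb : ∀ i, exp (Complex.I • C) (b i) =
      Complex.exp (Complex.I * (hs.eigenvalues rfl i : ℂ)) • b i := by
    intro i
    refine exp_apply_of_apply_eq_smul ?_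
    have := hs.apply_eigenvectorBasis rfl i
    simp only [smul_apply]
    erw [this]
    rw [smul_smul]; rfl
  rw [hs.trace_eq_sum_eigenvalues rfl, ← LinearMap.det_toMatrix b.toBasis]
  have : LinearMap.toMatrix b.toBasis b.toBasis
      ((exp (Complex.I • C) : V →L[ℂ] V) : V →ₗ[ℂ] V) =
      Matrix.diagonal fun i => Complex.exp (Complex.I * (hs.eigenvalues rfl i : ℂ)) := by
    ext i j
    rw [LinearMap.toMatrix_apply]
    simp only [OrthonormalBasis.coe_toBasis, ContinuousLinearMap.coe_coe, hb]
    rcases eq_or_ne i j with rfl | hij <;> simp [b.repr_self, *]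
  rw [this, Matrix.det_diagonal, ← Complex.exp_sum, ← Finset.mul_sum]
  simp

/-- The functional calculus is applied to `Complex.arg`. Its branch cut is harmless, as every
function is continuous on a finite spectrum. -/
theorem exists_selfAdjoint_exp_eq {U : V →L[ℂ] V} (hU : U ∈ unitary (V →L[ℂ] V)) :
    ∃ C : V →L[ℂ] V, IsSelfAdjoint C ∧ exp (Complex.I • C) = U := by
  have hn : IsStarNormal U := ⟨by
    rw [Commute, SemiconjBy, Unitary.star_mul_self_of_mem hU, Unitary.mul_star_self_of_mem hU]⟩
  have hfin : (spectrum ℂ U).Finite := by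
    rw [← AlgEquiv.spectrum_eq (Module.End.toContinuousLinearMap V).symm U]
    exact Module.End.finite_spectrum _
  refine ⟨cfc (fun z : ℂ => (Complex.arg z : ℂ)) U, .cfc_arg U, ?_⟩
  have hc : ContinuousOn (fun z : ℂ => (Complex.arg z : ℂ)) (spectrum ℂ U) :=
    hfin.continuousOn _
  rw [← CFC.exp_eq_normedSpace_exp (𝕜 := ℂ), ← cfc_comp_smul .., ← cfc_comp' ..]
  conv_rhs => rw [← cfc_id' ℂ U]
  refine cfc_congr fun y hy => ?_
  have hy₁ : ‖y‖ = 1 := spectrum.norm_eq_one_of_unitary hU hy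
  have h2 : Complex.I * y.arg = Complex.log y :=
    Complex.ext (by simp [Complex.log_re, hy₁]) (by simp [Complex.log_im])
  have hy0 : y ≠ 0 := by rintro rfl; simp at hy₁
  simpa [← Complex.exp_eq_exp_ℂ, h2] using Complex.exp_log hy0

/-- Subtracting r times the projection onto one eigenvector shifts a single eigenvalue by a multiple
of 2π, which the exponential does not see. -/
theorem exists_exp_eq_of_trace_sub {V : Type*} [NormedAddCommGroup V] [InnerProductSpace ℂ V]
    [CompleteSpace V] {ι : Type*} [Fintype ι] [DecidableEq ι] {C : V →L[ℂ] V}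
    (hC : IsSelfAdjoint C) (b : OrthonormalBasis ι ℂ V) {l : ι → ℂ}
    (hb : ∀ i, C (b i) = l i • b i) (i₀ : ι) (n : ℤ) {r : ℝ} (hr : (r : ℂ) = n * (2 * Real.pi)) :
    ∃ D : V →L[ℂ] V, IsSelfAdjoint D ∧
      LinearMap.trace ℂ V (D : V →ₗ[ℂ] V) = LinearMap.trace ℂ V (C : V →ₗ[ℂ] V) - r ∧
      exp (Complex.I • D) = exp (Complex.I • C) := by
  obtain ⟨p, hpa, hp⟩ : ∃ p : V →L[ℂ] V, IsSelfAdjoint p ∧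
      ∀ i, p (b i) = (if i = i₀ then (1 : ℂ) else 0) • b i := by
    refine ⟨(ℂ ∙ b i₀).starProjection, isSelfAdjoint_starProjection _, fun i => ?_⟩
    have h1 : ‖b i₀‖ = 1 := b.orthonormal.1 i₀
    rw [Submodule.starProjection_unit_singleton ℂ h1, orthonormal_iff_ite.1 b.orthonormal]
    rcases eq_or_ne i i₀ with rfl | h
    · simp
    · simp [h, h.symm]
  have hCp : ∀ i, (C - (r : ℂ) • p) (b i) =
      (l i - (r : ℂ) * (if i = i₀ then (1 : ℂ) else 0)) • b i := fun i => by
    rw [sub_apply, smul_apply, hb, hp, smul_smul, ← sub_smul]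
  refine ⟨C - (r : ℂ) • p, 
    hC.sub (IsSelfAdjoint.smul (Complex.conj_ofReal r) hpa), ?_, ?_⟩
  · have htp : LinearMap.trace ℂ V (p : V →ₗ[ℂ] V) = 1 := by
      rw [LinearMap.trace_eq_sum_inner _ b]
      simp only [ContinuousLinearMap.coe_coe, hp, inner_smul_right]
      simp [b.orthonormal.1]
    rw [ContinuousLinearMap.toLinearMap_sub, ContinuousLinearMap.toLinearMap_smul,
      map_sub, map_smul, htp, smul_eq_mul, mul_one]
  · refine ContinuousLinearMap.coe_injective (b.toBasis.ext fun i => ?_)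
    simp only [OrthonormalBasis.coe_toBasis, ContinuousLinearMap.coe_coe]
    rw [exp_apply_of_apply_eq_smul (A := Complex.I • C) (c := Complex.I * l i)
        (by rw [smul_apply, hb, smul_smul]),
      exp_apply_of_apply_eq_smul
        (c := Complex.I * (l i - (r : ℂ) * (if i = i₀ then (1 : ℂ) else 0)))
        (by rw [smul_apply, hCp, smul_smul])]
    congr 1
    split_ifs
    · rw [Complex.exp_eq_exp_iff_exists_int]
      exact ⟨-n, by rw [hr]; push_cast; ring⟩
    · simp

theorem exists_traceless_exp_eq {U : V →L[ℂ] V} (hU : U ∈ unitary (V →L[ℂ] V))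
    (hdet : LinearMap.det (U : V →ₗ[ℂ] V) = 1) :
    ∃ C : V →L[ℂ] V, IsSelfAdjoint C ∧ LinearMap.trace ℂ V (C : V →ₗ[ℂ] V) = 0 ∧
      exp (Complex.I • C) = U := by
  obtain ⟨C, hC, rfl⟩ := exists_selfAdjoint_exp_eq hU
  rw [det_exp_I_smul hC, Complex.exp_eq_one_iff] at hdet
  obtain ⟨n, hn⟩ := hdet
  have htr : LinearMap.trace ℂ V (C : V →ₗ[ℂ] V) = n * (2 * Real.pi) :=
    mul_left_cancel₀ Complex.I_ne_zero (by rw [hn]; ring)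
  -- In dimension zero there is no eigenvector to shift, but the trace already vanishes.
  rcases Nat.eq_zero_or_pos (Module.finrank ℂ V) with h0 | hpos
  · have : Subsingleton V := Module.finrank_zero_iff.1 h0
    exact ⟨C, hC, by rw [Subsingleton.elim (C : V →ₗ[ℂ] V) 0, map_zero], rfl⟩
  obtain ⟨D, hD, htD, hexp⟩ := exists_exp_eq_of_trace_sub hC _
    ((ContinuousLinearMap.isSelfAdjoint_iff_isSymmetric.1 hC).apply_eigenvectorBasis rfl)
    ⟨0, hpos⟩ n (r := n * (2 * Real.pi)) (by push_cast; ring)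
  exact ⟨D, hD, by rw [htD, htr]; push_cast; ring, hexp⟩

/-- `det_exp_I_smul`, transported along an intertwiner. -/
theorem exists_exp_comp_eq_comp {E : Type*} [NormedAddCommGroup E] [NormedSpace ℂ E]
    [CompleteSpace E] {C : V →L[ℂ] V} (hC : IsSelfAdjoint C) {A : E →L[ℂ] E} {L : V →L[ℂ] E}
    (h : A ∘L L = L ∘L (Complex.I • C)) :
    ∃ T : V →L[ℂ] V, exp A ∘L L = L ∘L T ∧ LinearMap.det (T : V →ₗ[ℂ] V) =
      Complex.exp (Complex.I * LinearMap.trace ℂ V (C : V →ₗ[ℂ] V)) :=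
  ⟨_, exp_comp_eq_comp_exp h, det_exp_I_smul hC⟩

/-- `exists_traceless_exp_eq`, transported along intertwiners. -/
theorem exists_traceless_exp_comp_eq {E : Type*} [NormedAddCommGroup E] [NormedSpace ℂ E]
    [CompleteSpace E] {U : V →L[ℂ] V} (hU : U ∈ unitary (V →L[ℂ] V))
    (hdet : LinearMap.det (U : V →ₗ[ℂ] V) = 1) :
    ∃ C : V →L[ℂ] V, IsSelfAdjoint C ∧ LinearMap.trace ℂ V (C : V →ₗ[ℂ] V) = 0 ∧
      ∀ (A : E →L[ℂ] E) (L : V →L[ℂ] E), A ∘L L = L ∘L (Complex.I • C) →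
        exp A ∘L L = L ∘L U := by
  obtain ⟨C, hC, htr, hexp⟩ := exists_traceless_exp_eq hU hdet
  exact ⟨C, hC, htr, fun A L h => hexp ▸ exp_comp_eq_comp_exp h⟩

end FiniteDimensional

end BlockControl

namespace BlockControl

open Filter Topology

theorem eq_of_forall_norm_sub_lt {F : Type*} [NormedAddCommGroup F] {a b : F} (C : ℝ)
    (h : ∀ ε : ℝ, 0 < ε → ‖a - b‖ ≤ C * ε) :
    a = b := by
  have : ‖a - b‖ ≤ 0 := by
    have ht : Tendsto (fun ε : ℝ => C * ε) (𝓝[>] 0) (𝓝 (C * 0)) :=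
      ((continuous_const_mul C).tendsto 0).mono_left nhdsWithin_le_nhds
    rw [mul_zero] at ht
    exact ge_of_tendsto ht (eventually_mem_nhdsWithin.mono h)
  exact sub_eq_zero.1 (norm_le_zero_iff.1 this)

variable {E : Type*} [NormedAddCommGroup E] [InnerProductSpace ℂ E] [CompleteSpace E]

/-! ### The decomposition into charge spaces -/

section Charges

variable (X : ChargeSymmetry E)

theorem unitary_inner_map (U : unitary (E →L[ℂ] E)) (ψ φ : E) :
    ⟪(U : E →L[ℂ] E) ψ, (U : E →L[ℂ] E) φ⟫_ℂ = ⟪ψ, φ⟫_ℂ :=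
  ContinuousLinearMap.inner_map_map_of_mem_unitary U.2 ψ φ

theorem unitary_norm_map (U : unitary (E →L[ℂ] E)) (ψ : E) : ‖(U : E →L[ℂ] E) ψ‖ = ‖ψ‖ :=
  ContinuousLinearMap.norm_map_of_mem_unitary U.2 ψ

theorem ChargeSymmetry.inner_rep_of_mem {μ : ℤ} {c : E} (hc : c ∈ X.space μ) (z : Circle) (φ : E) :
    ⟪c, (X.rep z : E →L[ℂ] E) φ⟫_ℂ = (z : ℂ) ^ μ * ⟪c, φ⟫_ℂ := by
  have h := unitary_inner_map (X.rep z) c φ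
  rw [hc z, inner_smul_left] at h
  have hz : (z : ℂ) ^ μ * (starRingEnd ℂ) ((z : ℂ) ^ μ) = 1 := by
    rw [Complex.mul_conj, Complex.normSq_eq_norm_sq, norm_zpow, Circle.norm_coe]; simp
  rw [← h, ← mul_assoc, hz, one_mul]

theorem ChargeSymmetry.inner_eq_zero {μ ν : ℤ} (hμν : μ ≠ ν) {ψ φ : E} (hψ : ψ ∈ X.space μ)
    (hφ : φ ∈ X.space ν) : ⟪ψ, φ⟫_ℂ = 0 := by
  -- This z satisfies z ^ (ν - μ) = -1, so the two characters take opposite values at it.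
  have h := X.inner_rep_of_mem hψ (Circle.exp (Real.pi / (ν - μ))) φ
  rw [hφ, inner_smul_right] at h
  set z : ℂ := (Circle.exp (Real.pi / (ν - μ)) : ℂ) with hz
  have hz0 : z ≠ 0 := Circle.coe_ne_zero _
  have hk : ((ν : ℂ) - μ) ≠ 0 := sub_ne_zero.2 (by exact_mod_cast hμν.symm)
  have h1 : z ^ (ν - μ) = -1 := by
    rw [hz, Circle.coe_exp, ← Complex.exp_int_mul, ← Complex.exp_pi_mul_I]
    congr 1
    push_cast
    field_simp
  have h2 : z ^ ν = -z ^ μ := by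
    rw [← sub_add_cancel ν μ, zpow_add₀ hz0, h1, neg_one_mul]
  rw [h2, neg_mul] at h
  have h3 : (z ^ μ) * ⟪ψ, φ⟫_ℂ = 0 := by linear_combination (-1 / 2 : ℂ) * h
  exact (mul_eq_zero.1 h3).resolve_left (zpow_ne_zero _ hz0)

/-- The orbit of a vector under the representation, as a function on `ℝ / ℤ`. -/
noncomputable def ChargeSymmetry.orbit (ψ : E) : UnitAddCircle → E :=
  fun t => (X.rep (AddCircle.toCircle t) : E →L[ℂ] E) ψ

theorem ChargeSymmetry.continuous_orbit (ψ : E) : Continuous (X.orbit ψ) :=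
  (X.strongly_continuous ψ).comp AddCircle.continuous_toCircle

theorem ChargeSymmetry.orbit_add (ψ : E) (s t : UnitAddCircle) :
    X.orbit ψ (s + t) = (X.rep (AddCircle.toCircle s) : E →L[ℂ] E) (X.orbit ψ t) := by
  simp [orbit, AddCircle.toCircle_add, map_mul]

theorem ChargeSymmetry.integrable_fourier_smul_orbit (ψ : E) (n : ℤ) :
    MeasureTheory.Integrable (fun t => fourier (-n) t • X.orbit ψ t) AddCircle.haarAddCircle :=
  (((fourier (-n)).continuous.smul (X.continuous_orbit ψ)).integrable_of_hasCompactSupport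
    (HasCompactSupport.of_compactSpace _))

/-- The coefficient is the Haar average of z ^ (-n) • π(z) ψ; translation invariance makes π act on
it by the character z ^ n. -/
theorem ChargeSymmetry.fourierCoeff_orbit_mem (ψ : E) (n : ℤ) :
    fourierCoeff (X.orbit ψ) n ∈ X.space n := by
  intro z
  obtain ⟨s, rfl⟩ : ∃ s : UnitAddCircle, AddCircle.toCircle s = z :=
    ⟨(AddCircle.homeomorphCircle one_ne_zero).symm z, by
      rw [← AddCircle.homeomorphCircle_apply one_ne_zero]; simp⟩
  have key : ∀ t : UnitAddCircle, (X.rep (AddCircle.toCircle s) : E →L[ℂ] E)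
      (fourier (-n) t • X.orbit ψ t) = ((AddCircle.toCircle s : ℂ) ^ n) •
        (fourier (-n) (s + t) • X.orbit ψ (s + t)) := by
    intro t
    rw [map_smul, ← X.orbit_add, smul_smul]
    congr 1
    have h1 : ∀ t : UnitAddCircle, fourier (-n) t = (AddCircle.toCircle t : ℂ) ^ (-n) := fun t => by
      rw [fourier_apply, AddCircle.toCircle_zsmul, Circle.coe_zpow]
    have hs := Circle.coe_ne_zero (AddCircle.toCircle s)
    rw [h1, h1, AddCircle.toCircle_add, Circle.coe_mul, mul_zpow, ← mul_assoc, ← zpow_add₀ hs,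
      add_neg_cancel, zpow_zero, one_mul]
  unfold fourierCoeff
  rw [← ContinuousLinearMap.integral_comp_comm _ (X.integrable_fourier_smul_orbit ψ n)]
  simp_rw [key]
  rw [MeasureTheory.integral_smul, MeasureTheory.integral_add_left_eq_self
    (fun t => fourier (-n) t • X.orbit ψ t) s]

theorem ChargeSymmetry.inner_fourierCoeff_orbit (φ ψ : E) (n : ℤ) :
    ⟪φ, fourierCoeff (X.orbit ψ) n⟫_ℂ = fourierCoeff (fun t => ⟪φ, X.orbit ψ t⟫_ℂ) n := by
  unfold fourierCoeff
  rw [← integral_inner (X.integrable_fourier_smul_orbit ψ n)]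
  simp [inner_smul_right]

/-- The Fourier coefficients of the orbit lie in the charge spaces and are orthogonal to themselves,
hence vanish. So the continuous function ⟪ψ, π(z) ψ⟫ has zero Fourier series, and its value at z = 1
is ‖ψ‖². -/
theorem ChargeSymmetry.eq_zero_of_orthogonal {ψ : E}
    (h : ∀ μ : ℤ, ∀ c ∈ X.space μ, ⟪c, ψ⟫_ℂ = 0) : ψ = 0 := by
  have hc : ∀ n, fourierCoeff (X.orbit ψ) n = 0 := by
    intro n
    have hm := X.fourierCoeff_orbit_mem ψ n
    rw [← inner_self_eq_zero (𝕜 := ℂ), X.inner_fourierCoeff_orbit]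
    have : ∀ t, ⟪fourierCoeff (X.orbit ψ) n, X.orbit ψ t⟫_ℂ = 0 := fun t => by
      rw [ChargeSymmetry.orbit, X.inner_rep_of_mem hm, h _ _ hm, mul_zero]
    simp only [this]
    simp [fourierCoeff]
  let f : C(UnitAddCircle, ℂ) :=
    ⟨fun t => ⟪ψ, X.orbit ψ t⟫_ℂ, continuous_const.inner (X.continuous_orbit ψ)⟩
  have hf : fourierCoeff f = 0 := by
    funext n
    change fourierCoeff (fun t => ⟪ψ, X.orbit ψ t⟫_ℂ) n = 0
    rw [← X.inner_fourierCoeff_orbit, hc, inner_zero_right]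
  have hsum := has_pointwise_sum_fourier_series_of_summable (f := f)
    (by rw [hf]; exact summable_zero) 0
  rw [hf] at hsum
  have h0 : f 0 = 0 := hsum.unique (by simp)
  simpa [f, ChargeSymmetry.orbit] using h0

theorem ChargeSymmetry.space_eq_bot {μ : ℤ} (hμ : μ < 0) : X.space μ = ⊥ := X.nonneg_charges μ hμ

/-- The span of the charge spaces with charge at most `K`. -/
noncomputable def ChargeSymmetry.upTo (K : ℕ) : Submodule ℂ E := ⨆ μ : Fin (K + 1), X.space (μ : ℕ)

instance (K : ℕ) : FiniteDimensional ℂ (X.upTo K) := by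
  unfold ChargeSymmetry.upTo; infer_instance

theorem ChargeSymmetry.space_le_upTo {μ K : ℕ} (h : μ ≤ K) : X.space μ ≤ X.upTo K :=
  le_iSup (fun μ : Fin (K + 1) => X.space (μ : ℕ)) ⟨μ, Nat.lt_succ_of_le h⟩

theorem ChargeSymmetry.upTo_le {K : ℕ} {S : Submodule ℂ E} (h : ∀ μ : ℕ, μ ≤ K → X.space μ ≤ S) :
    X.upTo K ≤ S :=
  iSup_le fun μ => h μ (Nat.le_of_lt_succ μ.2)

theorem ChargeSymmetry.upTo_mono : Monotone X.upTo := fun _ _ h =>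
  X.upTo_le fun _ hμ => X.space_le_upTo (hμ.trans h)

theorem ChargeSymmetry.dense_upTo : (⨆ K, X.upTo K).topologicalClosure = ⊤ := by
  rw [Submodule.topologicalClosure_eq_top_iff, Submodule.eq_bot_iff]
  intro ψ hψ
  refine X.eq_zero_of_orthogonal fun μ c hc => ?_
  rcases lt_or_ge μ 0 with hμ | hμ
  · rw [X.space_eq_bot hμ, Submodule.mem_bot] at hc
    rw [hc, inner_zero_left]
  · obtain ⟨n, rfl⟩ := Int.eq_ofNat_of_zero_le hμ
    exact (Submodule.mem_orthogonal _ _).1 hψ c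
      ((X.space_le_upTo le_rfl).trans (le_iSup X.upTo n) hc)

/-- The projection onto the charges at most `K`. -/
noncomputable def ChargeSymmetry.cutoff (K : ℕ) : E →L[ℂ] E := (X.upTo K).starProjection

theorem ChargeSymmetry.cutoff_mem (K : ℕ) (ψ : E) : X.cutoff K ψ ∈ X.upTo K :=
  Submodule.starProjection_apply_mem _ _

theorem ChargeSymmetry.cutoff_of_mem {K : ℕ} {ψ : E} (h : ψ ∈ X.upTo K) : X.cutoff K ψ = ψ :=
  Submodule.starProjection_eq_self_iff.2 h

theorem ChargeSymmetry.norm_cutoff_le (K : ℕ) (ψ : E) : ‖X.cutoff K ψ‖ ≤ ‖ψ‖ :=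
  Submodule.norm_starProjection_apply_le _ _

theorem ChargeSymmetry.tendsto_cutoff (ψ : E) :
    Tendsto (fun K => X.cutoff K ψ) atTop (𝓝 ψ) :=
  Submodule.starProjection_tendsto_self X.upTo X.upTo_mono ψ X.dense_upTo.ge

theorem ChargeSymmetry.proj_of_mem {μ : ℤ} {ψ : E} (h : ψ ∈ X.space μ) : X.proj μ ψ = ψ :=
  Submodule.starProjection_eq_self_iff.2 h

theorem ChargeSymmetry.proj_mem (μ : ℤ) (ψ : E) : X.proj μ ψ ∈ X.space μ :=
  Submodule.starProjection_apply_mem _ _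

theorem ChargeSymmetry.proj_of_mem_of_ne {μ ν : ℤ} (hμν : μ ≠ ν) {ψ : E} (h : ψ ∈ X.space ν) :
    X.proj μ ψ = 0 :=
  Submodule.starProjection_apply_eq_zero_iff _ |>.2 fun _ hc => X.inner_eq_zero hμν hc h

theorem ChargeSymmetry.cutoff_eq_sum (K : ℕ) :
    X.cutoff K = ∑ μ ∈ Finset.range (K + 1), X.proj (μ : ℕ) := by
  ext ψ
  refine Submodule.eq_starProjection_of_mem_of_inner_eq_zero ?_ ?_
  · rw [sum_apply]
    exact Submodule.sum_mem _ fun μ hμ =>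
      X.space_le_upTo (Nat.le_of_lt_succ (Finset.mem_range.1 hμ)) (X.proj_mem _ _)
  · intro w hw
    revert w
    have : X.upTo K ≤ (ℂ ∙ (ψ - (∑ μ ∈ Finset.range (K + 1), X.proj (μ : ℕ)) ψ))ᗮ := by
      refine X.upTo_le fun ν hν w hw => ?_
      rw [Submodule.mem_orthogonal_singleton_iff_inner_right, inner_sub_left,
        sum_apply, sum_inner, Finset.sum_eq_single_of_mem ν
          (Finset.mem_range.2 (Nat.lt_succ_of_le hν)), ← inner_sub_left]
      · exact Submodule.starProjection_inner_eq_zero _ _ hw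
      · intro μ _ hμ
        exact X.inner_eq_zero (by exact_mod_cast hμ) (X.proj_mem _ _) hw
    exact fun w hw => Submodule.mem_orthogonal_singleton_iff_inner_right.1 (this hw)

theorem ChargeSymmetry.eqOn_upTo {F : Type*} [NormedAddCommGroup F] [NormedSpace ℂ F]
    {A B : E →L[ℂ] F} {K : ℕ} (h : ∀ μ : ℕ, μ ≤ K → ∀ ψ ∈ X.space μ, A ψ = B ψ) {ψ : E}
    (hψ : ψ ∈ X.upTo K) : A ψ = B ψ := by
  have : X.upTo K ≤ LinearMap.eqLocus (A : E →ₗ[ℂ] F) (B : E →ₗ[ℂ] F) :=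
    X.upTo_le fun μ hμ ψ hψ => h μ hμ ψ hψ
  exact this hψ

/-- Extensionality by density; non-negativity of the charges enters through
`ChargeSymmetry.dense_upTo`. -/
theorem ChargeSymmetry.clm_ext {F : Type*} [NormedAddCommGroup F] [NormedSpace ℂ F]
    {A B : E →L[ℂ] F} (h : ∀ μ : ℕ, ∀ ψ ∈ X.space μ, A ψ = B ψ) : A = B := by
  ext ψ
  refine tendsto_nhds_unique ((A.continuous.tendsto _).comp (X.tendsto_cutoff ψ)) ?_
  refine ((B.continuous.tendsto _).comp (X.tendsto_cutoff ψ)).congr fun K => ?_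
  exact (X.eqOn_upTo (fun μ _ => h μ) (X.cutoff_mem K ψ)).symm

theorem starProjection_comm_of_maps {V : Submodule ℂ E} [V.HasOrthogonalProjection]
    {B : E →L[ℂ] E} (h₁ : ∀ ψ ∈ V, B ψ ∈ V) (h₂ : ∀ ψ ∈ V, (star B) ψ ∈ V) (ψ : E) :
    V.starProjection (B ψ) = B (V.starProjection ψ) := by
  refine Submodule.eq_starProjection_of_mem_of_inner_eq_zero
    (h₁ _ (Submodule.starProjection_apply_mem _ _)) fun w hw => ?_
  rw [← map_sub, ← ContinuousLinearMap.adjoint_inner_right]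
  exact Submodule.starProjection_inner_eq_zero _ _ (h₂ w hw)

end Charges

/-! ### Compressions -/

section Compression

variable {E : Type*} [NormedAddCommGroup E] [InnerProductSpace ℂ E]
  {V : Submodule ℂ E} [V.HasOrthogonalProjection]

theorem coe_compression_apply (A : E →L[ℂ] E) (v : V) :
    (compression V A v : E) = V.starProjection (A v) := rfl

theorem coe_compression_apply_of_mem {A : E →L[ℂ] E} {v : V} (h : A v ∈ V) :
    (compression V A v : E) = A v := by
  rw [coe_compression_apply, Submodule.starProjection_eq_self_iff.2 h]

theorem compression_one : compression V (1 : E →L[ℂ] E) = LinearMap.id := by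
  ext v
  exact coe_compression_apply_of_mem v.2

theorem compression_mul {A B : E →L[ℂ] E} (h : ∀ ψ ∈ V, B ψ ∈ V) :
    compression V (A * B) = compression V A ∘ₗ compression V B := by
  ext v
  rw [LinearMap.comp_apply, coe_compression_apply, coe_compression_apply,
    coe_compression_apply_of_mem (h v v.2)]
  rfl

end Compression

/-! ### The group `𝒮𝒰(X)` -/

section SU

variable {X : ChargeSymmetry E}

theorem ChargeSymmetry.map_space_of_comm {U : unitary (E →L[ℂ] E)}
    (h : ∀ z : Circle, X.rep z * U = U * X.rep z) (μ : ℤ) {ψ : E} (hψ : ψ ∈ X.space μ) :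
    (U : E →L[ℂ] E) ψ ∈ X.space μ := by
  intro z
  have := DFunLike.congr_fun (congrArg Subtype.val (h z)) ψ
  change (X.rep z : E →L[ℂ] E) ((U : E →L[ℂ] E) ψ) =
    (U : E →L[ℂ] E) ((X.rep z : E →L[ℂ] E) ψ) at this
  rw [this, hψ z, map_smul]

theorem ChargeSymmetry.map_upTo_of_comm {U : unitary (E →L[ℂ] E)}
    (h : ∀ z : Circle, X.rep z * U = U * X.rep z) (K : ℕ) {ψ : E} (hψ : ψ ∈ X.upTo K) :
    (U : E →L[ℂ] E) ψ ∈ X.upTo K := by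
  have : X.upTo K ≤ (X.upTo K).comap ((U : E →L[ℂ] E) : E →ₗ[ℂ] E) :=
    X.upTo_le fun μ hμ ψ hψ => X.space_le_upTo hμ (X.map_space_of_comm h μ hψ)
  exact this hψ

theorem ChargeSymmetry.comm_star {U : unitary (E →L[ℂ] E)}
    (h : ∀ z : Circle, X.rep z * U = U * X.rep z) (z : Circle) :
    X.rep z * U⁻¹ = U⁻¹ * X.rep z := by
  rw [mul_inv_eq_iff_eq_mul, mul_assoc, h, inv_mul_cancel_left]

theorem ChargeSymmetry.cutoff_comm_of_comm {U : unitary (E →L[ℂ] E)}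
    (h : ∀ z : Circle, X.rep z * U = U * X.rep z) (K : ℕ) (ψ : E) :
    X.cutoff K ((U : E →L[ℂ] E) ψ) = (U : E →L[ℂ] E) (X.cutoff K ψ) :=
  starProjection_comm_of_maps (fun _ hψ => X.map_upTo_of_comm h K hψ)
    (fun _ hψ => X.map_upTo_of_comm (X.comm_star h) K hψ) ψ

variable (X) in
/-- `𝒮𝒰(X)` as a subgroup of the unitary group. -/
def ChargeSymmetry.SUSubgroup : Subgroup (unitary (E →L[ℂ] E)) where
  carrier := X.SU
  one_mem' := ⟨fun z => by simp, fun μ => by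
    rw [OneMemClass.coe_one, compression_one, LinearMap.det_id]⟩
  mul_mem' := by
    rintro U V ⟨hU, hU'⟩ ⟨hV, hV'⟩
    refine ⟨fun z => by rw [← mul_assoc, hU, mul_assoc, hV, mul_assoc], fun μ => ?_⟩
    rw [Submonoid.coe_mul, compression_mul fun _ hψ => X.map_space_of_comm hV μ hψ,
      LinearMap.det_comp, hU', hV', mul_one]
  inv_mem' := by
    rintro U ⟨hU, hU'⟩
    refine ⟨X.comm_star hU, fun μ => ?_⟩
    have h1 : compression (X.space μ) ((U⁻¹ * U : unitary (E →L[ℂ] E)) : E →L[ℂ] E) =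
        LinearMap.id := by rw [inv_mul_cancel, OneMemClass.coe_one, compression_one]
    rw [Submonoid.coe_mul, compression_mul fun _ hψ => X.map_space_of_comm hU μ hψ] at h1
    have h2 := congrArg LinearMap.det h1
    rwa [LinearMap.det_comp, hU', mul_one, LinearMap.det_id] at h2

theorem ChargeSymmetry.isStronglyClosed_SU : IsStronglyClosed X.SU := by
  classical
  intro U hU
  refine ⟨fun z => ?_, fun μ => ?_⟩
  · refine Subtype.ext (ContinuousLinearMap.ext fun ψ => ?_)
    change (X.rep z : E →L[ℂ] E) ((U : E →L[ℂ] E) ψ) =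
      (U : E →L[ℂ] E) ((X.rep z : E →L[ℂ] E) ψ)
    refine eq_of_forall_norm_sub_lt 2 fun ε hε => ?_
    obtain ⟨W, ⟨hW, -⟩, hF⟩ := hU {ψ, (X.rep z : E →L[ℂ] E) ψ} ε hε
    have h1 := hF ψ (by simp)
    have h2 := hF ((X.rep z : E →L[ℂ] E) ψ) (by simp)
    have h3 := DFunLike.congr_fun (congrArg Subtype.val (hW z)) ψ
    change (X.rep z : E →L[ℂ] E) ((W : E →L[ℂ] E) ψ) =
      (W : E →L[ℂ] E) ((X.rep z : E →L[ℂ] E) ψ) at h3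
    rw [← unitary_norm_map (X.rep z)] at h1
    simp only [sub_apply, map_sub] at h1 h2
    rw [h3] at h1
    calc _ = ‖((W : E →L[ℂ] E) ((X.rep z : E →L[ℂ] E) ψ) -
            (U : E →L[ℂ] E) ((X.rep z : E →L[ℂ] E) ψ)) -
          ((W : E →L[ℂ] E) ((X.rep z : E →L[ℂ] E) ψ) -
            (X.rep z : E →L[ℂ] E) ((U : E →L[ℂ] E) ψ))‖ := by congr 1; abel
      _ ≤ _ := (norm_sub_le _ _).trans (by linarith)
  -- The determinant of a block is a continuous function of the images of finitely many basis
  -- vectors, so strong approximation controls it.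
  · let b := Module.finBasis ℂ (X.space μ)
    let Φ : (Fin (Module.finrank ℂ (X.space μ)) → E) → ℂ := fun w =>
      (Matrix.of fun i j => b.repr ((X.space μ).orthogonalProjectionOnto (w j)) i).det
    have hΦ : Continuous Φ := by
      refine Continuous.matrix_det (continuous_matrix fun i j => ?_)
      have h1 : Continuous fun v : X.space μ => b.repr v i :=
        LinearMap.continuous_of_finiteDimensional (b.coord i)
      exact h1.comp ((X.space μ).orthogonalProjectionOnto.continuous.comp (continuous_apply j))
    have hdet : ∀ A : E →L[ℂ] E, LinearMap.det (compression (X.space μ) A) =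
        Φ fun j => A (b j) := fun A => by
      rw [← LinearMap.det_toMatrix b]
      congr 1
      ext i j
      rw [LinearMap.toMatrix_apply]
      rfl
    have hcl : IsClosed (Φ ⁻¹' {1}) := isClosed_singleton.preimage hΦ
    rw [hdet]
    change (fun j => (U : E →L[ℂ] E) (b j)) ∈ Φ ⁻¹' {1}
    rw [← hcl.closure_eq, Metric.mem_closure_iff]
    intro ε hε
    obtain ⟨W, ⟨-, hW⟩, hF⟩ := hU (Finset.univ.image fun j => (b j : E)) ε hε
    refine ⟨fun j => (W : E →L[ℂ] E) (b j), ?_, ?_⟩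
    · change Φ _ = 1
      rw [← hdet, hW]
    · rw [dist_comm, dist_pi_lt_iff hε]
      intro j
      rw [dist_eq_norm]
      exact hF _ (Finset.mem_image_of_mem _ (Finset.mem_univ j))

end SU

end BlockControl

namespace BlockControl

open Filter Topology NormedSpace

variable {E : Type*} [NormedAddCommGroup E] [InnerProductSpace ℂ E] [CompleteSpace E]
  {X : ChargeSymmetry E}

/-! ### Truncations of a selfadjoint operator commuting with the charge -/

section Trunc

variable {H : E →ₗ.[ℂ] E} (hH : X.MemU H)

include hH

theorem ChargeSymmetry.MemU.inner_symm (x y : H.domain) : ⟪H x, (y : E)⟫_ℂ = ⟪(x : E), H y⟫_ℂ := by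
  have h := LinearPMap.adjoint_isFormalAdjoint hH.selfAdjoint.dense_domain
  have heq : H.adjoint = H := hH.selfAdjoint
  rw [heq] at h
  exact h x y

theorem ChargeSymmetry.MemU.map_space {μ : ℤ} {ψ : E} (hψ : ψ ∈ X.space μ) :
    H ⟨ψ, hH.space_le_domain μ hψ⟩ ∈ X.space μ := by
  obtain ⟨h, h'⟩ := hH.commutes μ ⟨ψ, hH.space_le_domain μ hψ⟩
  have : (⟨X.proj μ ψ, h⟩ : H.domain) = ⟨ψ, hH.space_le_domain μ hψ⟩ :=
    Subtype.ext (X.proj_of_mem hψ)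
  rw [this] at h'
  rw [h']
  exact X.proj_mem _ _

theorem ChargeSymmetry.MemU.proj_mem_domain (μ : ℤ) (ψ : E) : X.proj μ ψ ∈ H.domain :=
  hH.space_le_domain μ (X.proj_mem μ ψ)

theorem ChargeSymmetry.MemU.coe_block_apply (μ : ℤ) (v : X.space μ) :
    (X.block hH μ v : E) = H ⟨v, hH.space_le_domain μ v.2⟩ := by
  change X.proj μ (H ⟨v, hH.space_le_domain μ v.2⟩) = _
  exact X.proj_of_mem (hH.map_space v.2)

theorem ChargeSymmetry.MemU.trunc_apply (K : ℕ) (ψ : E) :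
    X.trunc hH K ψ = ∑ μ ∈ Finset.range (K + 1),
      H ⟨X.proj (μ : ℕ) ψ, hH.proj_mem_domain (μ : ℕ) ψ⟩ := by
  rw [ChargeSymmetry.trunc, sum_apply]
  exact Finset.sum_congr rfl fun μ _ => hH.coe_block_apply μ _

/-- The link between the unbounded operator and its truncations, valid on the whole domain because H
commutes with each projection. -/
theorem ChargeSymmetry.MemU.trunc_of_mem_domain (K : ℕ) (ψ : H.domain) :
    X.trunc hH K ψ = X.cutoff K (H ψ) := by
  rw [hH.trunc_apply, X.cutoff_eq_sum, sum_apply]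
  exact Finset.sum_congr rfl fun μ _ => (hH.commutes μ ψ).2

theorem ChargeSymmetry.MemU.trunc_of_mem {μ K : ℕ} (h : μ ≤ K) {ψ : E} (hψ : ψ ∈ X.space μ) :
    X.trunc hH K ψ = H ⟨ψ, hH.space_le_domain μ hψ⟩ := by
  rw [hH.trunc_of_mem_domain K ⟨ψ, hH.space_le_domain μ hψ⟩]
  exact X.cutoff_of_mem (X.space_le_upTo h (hH.map_space hψ))

omit hH in
theorem ChargeSymmetry.cutoff_of_lt {μ K : ℕ} (h : K < μ) {ψ : E} (hψ : ψ ∈ X.space μ) :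
    X.cutoff K ψ = 0 := by
  rw [X.cutoff_eq_sum, sum_apply]
  refine Finset.sum_eq_zero fun ν hν => X.proj_of_mem_of_ne ?_ hψ
  have := Finset.mem_range.1 hν
  omega

theorem ChargeSymmetry.MemU.trunc_of_lt {μ K : ℕ} (h : K < μ) {ψ : E} (hψ : ψ ∈ X.space μ) :
    X.trunc hH K ψ = 0 := by
  rw [hH.trunc_of_mem_domain K ⟨ψ, hH.space_le_domain μ hψ⟩]
  exact X.cutoff_of_lt h (hH.map_space hψ)

theorem ChargeSymmetry.MemU.trunc_comp_cutoff {M K : ℕ} (h : M ≤ K) :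
    X.trunc hH K ∘L X.cutoff M = X.trunc hH M := by
  refine X.clm_ext fun μ ψ hψ => ?_
  rw [ContinuousLinearMap.comp_apply]
  rcases le_or_gt μ M with hμ | hμ
  · rw [X.cutoff_of_mem (X.space_le_upTo hμ hψ), hH.trunc_of_mem (hμ.trans h) hψ,
      hH.trunc_of_mem hμ hψ]
  · rw [X.cutoff_of_lt hμ hψ, hH.trunc_of_lt hμ hψ, map_zero]

theorem ChargeSymmetry.MemU.cutoff_comp_trunc {M K : ℕ} (h : M ≤ K) :
    X.cutoff M ∘L X.trunc hH K = X.trunc hH M := by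
  refine X.clm_ext fun μ ψ hψ => ?_
  rw [ContinuousLinearMap.comp_apply]
  rcases le_or_gt μ K with hμ | hμ
  · rw [hH.trunc_of_mem hμ hψ]
    exact (hH.trunc_of_mem_domain M ⟨ψ, hH.space_le_domain μ hψ⟩).symm
  · rw [hH.trunc_of_lt hμ hψ, hH.trunc_of_lt (h.trans_lt hμ) hψ, map_zero]

theorem ChargeSymmetry.MemU.isSelfAdjoint_trunc (K : ℕ) : IsSelfAdjoint (X.trunc hH K) := by
  rw [ContinuousLinearMap.isSelfAdjoint_iff_isSymmetric]
  intro ψ φ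
  simp only [ContinuousLinearMap.coe_coe, hH.trunc_apply, sum_inner, inner_sum]
  refine Finset.sum_congr rfl fun μ _ => ?_
  have h1 := X.proj_of_mem (hH.map_space (X.proj_mem μ ψ))
  have h2 := X.proj_of_mem (hH.map_space (X.proj_mem μ φ))
  have hp : ∀ a b, ⟪X.proj μ a, b⟫_ℂ = ⟪a, X.proj μ b⟫_ℂ :=
    Submodule.inner_starProjection_left_eq_right _
  rw [← h1, hp, hH.inner_symm ⟨X.proj μ ψ, _⟩ ⟨X.proj μ φ, hH.proj_mem_domain μ φ⟩, hp, h2]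

theorem ChargeSymmetry.MemU.isSymmetric_block (μ : ℤ) : (X.block hH μ).IsSymmetric := by
  intro v w
  rw [Submodule.coe_inner, Submodule.coe_inner, hH.coe_block_apply, hH.coe_block_apply]
  exact hH.inner_symm ⟨v, hH.space_le_domain μ v.2⟩ ⟨w, hH.space_le_domain μ w.2⟩

/-- Since H equals its adjoint, a vector is in the domain as soon as it satisfies the weak identity
`key`, which is a limit of identities for the symmetric truncations. -/
theorem ChargeSymmetry.MemU.apply_eq_of_trunc_eq {ψ χ : E}
    (h : ∀ K, X.trunc hH K ψ = X.cutoff K χ) : ∃ hψ : ψ ∈ H.domain, H ⟨ψ, hψ⟩ = χ := by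
  have key : ∀ η : H.domain, ⟪χ, (η : E)⟫_ℂ = ⟪ψ, H η⟫_ℂ := by
    intro η
    refine tendsto_nhds_unique ((X.tendsto_cutoff χ).inner tendsto_const_nhds)
      (((tendsto_const_nhds (x := ψ)).inner (X.tendsto_cutoff (H η))).congr fun K => ?_)
    rw [← h, ← hH.trunc_of_mem_domain]
    exact (ContinuousLinearMap.isSelfAdjoint_iff_isSymmetric.1 (hH.isSelfAdjoint_trunc K) ψ η).symm
  have hd := LinearPMap.mem_adjoint_domain_of_exists (T := H) ψ ⟨χ, key⟩
  have hv := LinearPMap.adjoint_apply_eq hH.selfAdjoint.dense_domain ⟨ψ, hd⟩ key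
  have heq : H.adjoint = H := hH.selfAdjoint
  have : ∀ T : E →ₗ.[ℂ] E, T = H → (∃ h : ψ ∈ T.domain, T ⟨ψ, h⟩ = χ) →
      ∃ h : ψ ∈ H.domain, H ⟨ψ, h⟩ = χ := by
    rintro _ rfl h; exact h
  exact this _ heq ⟨hd, hv⟩

end Trunc

/-! ### The one-parameter group of the truncation -/

section TruncExp

variable {H : E →ₗ.[ℂ] E} (hH : X.MemU H)

/-- The unitary operator `exp (i t H^[K])`. -/
noncomputable def ChargeSymmetry.MemU.truncExp (K : ℕ) (t : ℝ) : E →L[ℂ] E :=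
  exp (t • Complex.I • X.trunc hH K)

theorem ChargeSymmetry.MemU.truncExp_mem_unitary (K : ℕ) (t : ℝ) :
    hH.truncExp K t ∈ unitary (E →L[ℂ] E) := by
  let +nondep : NormedAlgebra ℚ (E →L[ℂ] E) := .restrictScalars ℚ ℝ (E →L[ℂ] E)
  refine exp_mem_unitary_of_mem_skewAdjoint ?_
  rw [skewAdjoint.mem_iff, star_smul, star_smul, (hH.isSelfAdjoint_trunc K).star_eq]
  simp

theorem ChargeSymmetry.MemU.truncExp_add (K : ℕ) (s t : ℝ) :
    hH.truncExp K (s + t) = hH.truncExp K s * hH.truncExp K t := by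
  let +nondep : NormedAlgebra ℚ (E →L[ℂ] E) := .restrictScalars ℚ ℝ (E →L[ℂ] E)
  rw [truncExp, add_smul, exp_add_of_commute (((Commute.refl _).smul_left _).smul_right _)]
  rfl

theorem ChargeSymmetry.MemU.truncExp_zero (K : ℕ) : hH.truncExp K 0 = 1 := by
  rw [truncExp, zero_smul, exp_zero]

theorem ChargeSymmetry.MemU.truncExp_mul_neg (K : ℕ) (t : ℝ) :
    hH.truncExp K t * hH.truncExp K (-t) = 1 := by
  rw [← hH.truncExp_add, add_neg_cancel, truncExp_zero]

theorem ChargeSymmetry.MemU.hasDerivAt_truncExp (K : ℕ) (t : ℝ) :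
    HasDerivAt (hH.truncExp K) (hH.truncExp K t * (Complex.I • X.trunc hH K)) t :=
  hasDerivAt_exp_smul_const (𝕂 := ℝ) (Complex.I • X.trunc hH K) t

theorem ChargeSymmetry.MemU.truncExp_comp_cutoff {M K : ℕ} (h : M ≤ K) (t : ℝ) :
    hH.truncExp K t ∘L X.cutoff M = X.cutoff M ∘L hH.truncExp K t := by
  refine exp_comp_eq_comp_exp ?_
  simp only [ContinuousLinearMap.smul_comp, ContinuousLinearMap.comp_smul, hH.trunc_comp_cutoff h,
    hH.cutoff_comp_trunc h]

theorem ChargeSymmetry.MemU.truncExp_comp_cutoff_eq {M K : ℕ} (h : M ≤ K) (t : ℝ) :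
    hH.truncExp K t ∘L X.cutoff M = hH.truncExp M t ∘L X.cutoff M := by
  rw [hH.truncExp_comp_cutoff le_rfl]
  refine exp_comp_eq_comp_exp ?_
  simp only [ContinuousLinearMap.smul_comp, ContinuousLinearMap.comp_smul, hH.trunc_comp_cutoff h,
    hH.cutoff_comp_trunc le_rfl]

theorem ChargeSymmetry.MemU.truncExp_comp_one_sub_cutoff (K : ℕ) (t : ℝ) :
    hH.truncExp K t ∘L (1 - X.cutoff K) = 1 - X.cutoff K := by
  have := exp_comp_eq_comp_exp (A := t • Complex.I • X.trunc hH K) (B := 0) (L := 1 - X.cutoff K)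
    (by
      rw [ContinuousLinearMap.comp_sub, ContinuousLinearMap.comp_zero]
      simp only [ContinuousLinearMap.smul_comp, hH.trunc_comp_cutoff le_rfl]
      exact sub_self _)
  rw [exp_zero] at this
  exact this

theorem ChargeSymmetry.MemU.truncExp_eq_of_le {M K : ℕ} (h : M ≤ K) (t : ℝ) {ψ : E}
    (hψ : ψ ∈ X.upTo M) : hH.truncExp K t ψ = hH.truncExp M t ψ := by
  have := DFunLike.congr_fun (hH.truncExp_comp_cutoff_eq h t) ψ
  simpa only [ContinuousLinearMap.comp_apply, X.cutoff_of_mem hψ] using this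

theorem ChargeSymmetry.MemU.norm_truncExp (K : ℕ) (t : ℝ) (ψ : E) :
    ‖hH.truncExp K t ψ‖ = ‖ψ‖ :=
  ContinuousLinearMap.norm_map_of_mem_unitary (hH.truncExp_mem_unitary K t) ψ

/-- The sequence is eventually constant on vectors of bounded charge; isometry extends convergence
to all vectors. -/
theorem ChargeSymmetry.MemU.exists_tendsto_truncExp (t : ℝ) (ψ : E) :
    ∃ φ, Tendsto (fun K => hH.truncExp K t ψ) atTop (𝓝 φ) := by
  refine cauchySeq_tendsto_of_complete (Metric.cauchySeq_iff'.2 fun ε hε => ?_)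
  obtain ⟨M, hM⟩ := (Metric.tendsto_atTop.1 (X.tendsto_cutoff ψ)) (ε / 2) (half_pos hε)
  refine ⟨M, fun K hK => ?_⟩
  have key := hH.truncExp_eq_of_le hK t (X.cutoff_mem M ψ)
  have h1 := hM M le_rfl
  rw [dist_comm, dist_eq_norm] at h1
  have h2 : hH.truncExp K t ψ - hH.truncExp M t ψ =
      hH.truncExp K t (ψ - X.cutoff M ψ) - hH.truncExp M t (ψ - X.cutoff M ψ) := by
    rw [map_sub, map_sub, key]; abel
  rw [dist_eq_norm, h2]
  refine (norm_sub_le _ _).trans_lt ?_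
  rw [hH.norm_truncExp, hH.norm_truncExp]
  linarith

/-- Uniqueness for a linear equation with bounded coefficient: undoing the flow gives a curve of
zero derivative. -/
theorem ChargeSymmetry.MemU.eq_truncExp_of_hasDerivAt {K : ℕ} {k : ℝ → E}
    (hk : ∀ t, HasDerivAt k ((Complex.I • X.trunc hH K) (k t)) t) (t : ℝ) :
    k t = hH.truncExp K t (k 0) := by
  have hd : ∀ s, HasDerivAt (fun s => hH.truncExp K (-s) (k s)) 0 s := by
    intro s
    have h1 : HasDerivAt (fun s => hH.truncExp K (-s))
        (-(hH.truncExp K (-s) * (Complex.I • X.trunc hH K))) s := by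
      have := (hH.hasDerivAt_truncExp K (-s)).scomp s (hasDerivAt_neg s)
      simpa [Function.comp_def] using this
    have h2 : HasDerivAt (fun s => ((hH.truncExp K (-s)).restrictScalars ℝ))
        ((-(hH.truncExp K (-s) * (Complex.I • X.trunc hH K))).restrictScalars ℝ) s :=
      ((ContinuousLinearMap.restrictScalarsL ℂ E E ℝ ℝ).hasFDerivAt.comp_hasDerivAt s h1)
    have h3 := h2.clm_apply (hk s)
    exact h3.congr_deriv
      (neg_add_cancel (hH.truncExp K (-s) ((Complex.I • X.trunc hH K) (k s))))
  have hc := is_const_of_deriv_eq_zero (fun s => (hd s).differentiableAt)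
    (fun s => (hd s).deriv) t 0
  simp only [neg_zero, hH.truncExp_zero, one_apply_eq_self] at hc
  rw [← hc]
  exact (DFunLike.congr_fun (hH.truncExp_mul_neg K t) (k t)).symm

end TruncExp

/-- A strong limit of unitaries is in general only an isometry; convergence of the adjoints makes
its adjoint isometric too. -/
theorem exists_unitary_of_tendsto {W : ℕ → E →L[ℂ] E} (hW : ∀ K, W K ∈ unitary (E →L[ℂ] E))
    (h₁ : ∀ ψ, ∃ φ, Tendsto (fun K => W K ψ) atTop (𝓝 φ))
    (h₂ : ∀ ψ, ∃ φ, Tendsto (fun K => (star (W K)) ψ) atTop (𝓝 φ)) :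
    ∃ U : unitary (E →L[ℂ] E), ∀ ψ, Tendsto (fun K => W K ψ) atTop (𝓝 ((U : E →L[ℂ] E) ψ)) := by
  choose f hf using h₁
  choose g hg using h₂
  let A : E →L[ℂ] E := continuousLinearMapOfTendsto W (tendsto_pi_nhds.2 hf)
  let B : E →L[ℂ] E := continuousLinearMapOfTendsto (fun K => star (W K)) (tendsto_pi_nhds.2 hg)
  have hA : ∀ ψ, Tendsto (fun K => W K ψ) atTop (𝓝 (A ψ)) := hf
  have hB : ∀ ψ, Tendsto (fun K => (star (W K)) ψ) atTop (𝓝 (B ψ)) := hg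
  have hAB : B = ContinuousLinearMap.adjoint A := by
    rw [ContinuousLinearMap.eq_adjoint_iff]
    intro x y
    refine tendsto_nhds_unique ((hB x).inner tendsto_const_nhds)
      ((tendsto_const_nhds.inner (hA y)).congr fun K => ?_)
    exact (ContinuousLinearMap.adjoint_inner_left _ _ _).symm
  have hnA : ∀ ψ, ‖A ψ‖ = ‖ψ‖ := fun ψ => tendsto_nhds_unique (hA ψ).norm
    (by simp only [ContinuousLinearMap.norm_map_of_mem_unitary (hW _), tendsto_const_nhds])
  have hnB : ∀ ψ, ‖B ψ‖ = ‖ψ‖ := fun ψ => tendsto_nhds_unique (hB ψ).norm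
    (by simp only [ContinuousLinearMap.norm_map_of_mem_unitary (Unitary.star_mem (hW _)),
      tendsto_const_nhds])
  have h1 := (ContinuousLinearMap.norm_map_iff_adjoint_comp_self A).1 hnA
  have h2 := (ContinuousLinearMap.norm_map_iff_adjoint_comp_self B).1 hnB
  rw [hAB, ContinuousLinearMap.adjoint_adjoint] at h2
  exact ⟨⟨A, Unitary.mem_iff.2 ⟨h1, h2⟩⟩, hA⟩

/-! ### Existence and uniqueness of the one-parameter group -/

section ExpGroup

variable {H : E →ₗ.[ℂ] E} (hH : X.MemU H)

theorem ChargeSymmetry.MemU.exists_unitary_eq_truncExp (t : ℝ) :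
    ∃ U : unitary (E →L[ℂ] E),
      ∀ M, (U : E →L[ℂ] E) ∘L X.cutoff M = hH.truncExp M t ∘L X.cutoff M ∧
        (U : E →L[ℂ] E) ∘L X.cutoff M = X.cutoff M ∘L (U : E →L[ℂ] E) := by
  have hstar : ∀ K, star (hH.truncExp K t) = hH.truncExp K (-t) := fun K => by
    have h1 := Unitary.star_mul_self_of_mem (hH.truncExp_mem_unitary K t)
    exact left_inv_eq_right_inv h1 (hH.truncExp_mul_neg K t)
  obtain ⟨U, hU⟩ := exists_unitary_of_tendsto (fun K => hH.truncExp_mem_unitary K t)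
    (hH.exists_tendsto_truncExp t) (by
      simp only [hstar]; exact hH.exists_tendsto_truncExp (-t))
  refine ⟨U, fun M => ⟨?_, ?_⟩⟩
  · ext ψ
    refine tendsto_nhds_unique (hU _) (tendsto_const_nhds.congr' ?_)
    filter_upwards [eventually_ge_atTop M] with K hK
    exact (DFunLike.congr_fun (hH.truncExp_comp_cutoff_eq hK t) ψ).symm
  · ext ψ
    refine tendsto_nhds_unique (hU _)
      ((((X.cutoff M).continuous.tendsto _).comp (hU ψ)).congr' ?_)
    filter_upwards [eventually_ge_atTop M] with K hK
    exact (DFunLike.congr_fun (hH.truncExp_comp_cutoff hK t) ψ).symm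

theorem ChargeSymmetry.tendstoUniformly_cutoff (U : ℝ → unitary (E →L[ℂ] E)) (ψ : E) :
    TendstoUniformly (fun K t => (U t : E →L[ℂ] E) (X.cutoff K ψ))
      (fun t => (U t : E →L[ℂ] E) ψ) atTop := by
  rw [Metric.tendstoUniformly_iff]
  intro ε hε
  filter_upwards [(Metric.tendsto_nhds.1 (X.tendsto_cutoff ψ)) ε hε] with K hK t
  rw [dist_eq_norm, ← map_sub, unitary_norm_map, ← dist_eq_norm, dist_comm]
  exact hK

/-- Existence matters because `dynamicalGroup` constrains its subgroups only through groups
satisfying `IsExpGroup`; without one, H would contribute nothing. -/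
theorem ChargeSymmetry.MemU.exists_isExpGroup (hH : X.MemU H) :
    ∃ U : ℝ → unitary (E →L[ℂ] E), IsExpGroup H U := by
  choose U hU using hH.exists_unitary_eq_truncExp
  have hUc : ∀ t M ψ, (U t : E →L[ℂ] E) (X.cutoff M ψ) = hH.truncExp M t (X.cutoff M ψ) :=
    fun t M ψ => DFunLike.congr_fun (hU t M).1 ψ
  have hcomm : ∀ t M ψ, (U t : E →L[ℂ] E) (X.cutoff M ψ) = X.cutoff M ((U t : E →L[ℂ] E) ψ) :=
    fun t M ψ => DFunLike.congr_fun (hU t M).2 ψ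
  have hUs : ∀ t (M : ℕ) (ψ : E), ψ ∈ X.space M → (U t : E →L[ℂ] E) ψ = hH.truncExp M t ψ := by
    intro t M ψ hψ
    have := hUc t M ψ
    rwa [X.cutoff_of_mem (X.space_le_upTo le_rfl hψ)] at this
  have hder : ∀ M ψ t, HasDerivAt (fun t => (U t : E →L[ℂ] E) (X.cutoff M ψ))
      ((U t : E →L[ℂ] E) (Complex.I • X.trunc hH M ψ)) t := by
    intro M ψ t
    simp only [hUc]
    have h1 := (((ContinuousLinearMap.apply ℂ E (X.cutoff M ψ)).restrictScalars ℝ).hasFDerivAt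
      (x := hH.truncExp M t)).comp_hasDerivAt t (hH.hasDerivAt_truncExp M t)
    have h2 : X.trunc hH M (X.cutoff M ψ) = X.trunc hH M ψ :=
      DFunLike.congr_fun (hH.trunc_comp_cutoff le_rfl) ψ
    have h3 : X.cutoff M (X.trunc hH M ψ) = X.trunc hH M ψ :=
      DFunLike.congr_fun (hH.cutoff_comp_trunc le_rfl) ψ
    have h4 : (U t : E →L[ℂ] E) (Complex.I • X.trunc hH M ψ) =
        (hH.truncExp M t * (Complex.I • X.trunc hH M)) (X.cutoff M ψ) := by
      rw [← h3, map_smul, hUc, h3, mul_apply_eq_comp, smul_apply, map_smul, h2]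
    rw [h4]
    exact h1
  have hU0 : U 0 = 1 := Subtype.ext (X.clm_ext fun M ψ hψ => by
    rw [hUs 0 M ψ hψ, hH.truncExp_zero]; rfl)
  refine ⟨U, hU0, fun s t => Subtype.ext (X.clm_ext fun M ψ hψ => ?_), fun ψ => ?_,
    fun ψ φ => ⟨fun h => ?_, ?_⟩⟩
  · have h1 : hH.truncExp M t ψ ∈ X.upTo M := by
      rw [← hUs t M ψ hψ, ← X.cutoff_of_mem (X.space_le_upTo le_rfl hψ), hcomm]
      exact X.cutoff_mem _ _
    change _ = (U s : E →L[ℂ] E) ((U t : E →L[ℂ] E) ψ)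
    rw [hUs _ M ψ hψ, hUs t M ψ hψ, ← X.cutoff_of_mem h1, hUc, X.cutoff_of_mem h1,
      hH.truncExp_add]
    rfl
  · exact (ChargeSymmetry.tendstoUniformly_cutoff U ψ).continuous
      (Eventually.of_forall fun K => continuous_iff_continuousAt.2 fun t =>
        (hder K ψ t).continuousAt).frequently
  -- Cutting off the derivative at 0 determines all truncations at ψ, which is the domain criterion.
  · have h1 : ∀ K, X.trunc hH K ψ = X.cutoff K (-Complex.I • φ) := by
      intro K
      have h2 := (((X.cutoff K).restrictScalars ℝ).hasFDerivAt
        (x := (U 0 : E →L[ℂ] E) ψ)).comp_hasDerivAt (0 : ℝ) h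
      have h3 := hder K ψ 0
      simp only [hcomm] at h3
      have h4 := h2.unique h3
      rw [hU0] at h4
      simp only [ContinuousLinearMap.coe_restrictScalars', OneMemClass.coe_one,
        one_apply_eq_self] at h4
      rw [map_smul, h4, smul_smul]
      simp
    obtain ⟨hψ, h2⟩ := hH.apply_eq_of_trunc_eq h1
    exact ⟨hψ, by rw [h2, smul_smul]; simp⟩
  · rintro ⟨hψ, rfl⟩
    -- For ψ in the domain the derivatives of the cut-off orbits converge uniformly in t, so limit
    -- and derivative may be exchanged.
    have := hasDerivAt_of_tendstoUniformly
      (ChargeSymmetry.tendstoUniformly_cutoff (X := X) U (Complex.I • H ⟨ψ, hψ⟩))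
      (f := fun K t => (U t : E →L[ℂ] E) (X.cutoff K ψ))
      (g := fun t => (U t : E →L[ℂ] E) ψ)
      (Eventually.of_forall fun K t => by
        have h1 := hder K ψ t
        rwa [hH.trunc_of_mem_domain K ⟨ψ, hψ⟩, ← map_smul] at h1)
      (fun t => (((U t : E →L[ℂ] E).continuous.tendsto _).comp (X.tendsto_cutoff ψ))) 0
    simpa [hU0] using this

theorem ChargeSymmetry.MemU.eq_truncExp_of_isExpGroup {U : ℝ → unitary (E →L[ℂ] E)}
    (hU : IsExpGroup H U) {M : ℕ} {ψ : E} (hψ : ψ ∈ X.space M) (t : ℝ) :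
    (U t : E →L[ℂ] E) ψ = hH.truncExp M t ψ := by
  have hψd : ψ ∈ H.domain := hH.space_le_domain M hψ
  have hd0 := (hU.generator ψ _).2 ⟨hψd, rfl⟩
  have hadd : ∀ s r φ, (U (s + r) : E →L[ℂ] E) φ = (U s : E →L[ℂ] E) ((U r : E →L[ℂ] E) φ) :=
    fun s r φ => by rw [hU.map_add]; rfl
  have hd : ∀ s, HasDerivAt (fun r => (U (s + r) : E →L[ℂ] E) ψ)
      ((U s : E →L[ℂ] E) (Complex.I • H ⟨ψ, hψd⟩)) 0 := by
    intro s
    simp only [hadd]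
    exact (((U s : E →L[ℂ] E).restrictScalars ℝ).hasFDerivAt
      (x := (U 0 : E →L[ℂ] E) ψ)).comp_hasDerivAt (0 : ℝ) hd0
  -- The derivative of U (s + r) ψ at r = 0 is computed with the factors in either order; the
  -- equivalence in `generator` shows that U s preserves the domain and commutes with H at ψ.
  have hdom : ∀ s, ∃ h : (U s : E →L[ℂ] E) ψ ∈ H.domain,
      (U s : E →L[ℂ] E) (Complex.I • H ⟨ψ, hψd⟩) = Complex.I • H ⟨(U s : E →L[ℂ] E) ψ, h⟩ := by
    intro s
    refine (hU.generator _ _).1 ?_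
    have h1 := hd s
    simp only [add_comm s, hadd] at h1
    exact h1
  have hK : ∀ K, M ≤ K → X.cutoff K ((U t : E →L[ℂ] E) ψ) = hH.truncExp M t ψ := by
    intro K hMK
    -- After the cutoff the orbit solves a linear equation with the bounded operator iH^[K].
    have hk : ∀ s, HasDerivAt (fun s => X.cutoff K ((U s : E →L[ℂ] E) ψ))
        ((Complex.I • X.trunc hH K) (X.cutoff K ((U s : E →L[ℂ] E) ψ))) s := by
      intro s
      obtain ⟨h, heq⟩ := hdom s
      have h1 := hd s
      rw [heq] at h1
      have h2 : HasDerivAt (fun r => (U r : E →L[ℂ] E) ψ)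
          (Complex.I • H ⟨(U s : E →L[ℂ] E) ψ, h⟩) s := by
        have := HasDerivAt.comp_sub_const (f := fun r => (U (s + r) : E →L[ℂ] E) ψ) s s
          (by rwa [sub_self])
        simpa using this
      have h3 := (((X.cutoff K).restrictScalars ℝ).hasFDerivAt
        (x := (U s : E →L[ℂ] E) ψ)).comp_hasDerivAt s h2
      have h4 : X.trunc hH K (X.cutoff K ((U s : E →L[ℂ] E) ψ)) =
          X.cutoff K (H ⟨(U s : E →L[ℂ] E) ψ, h⟩) := by
        rw [← hH.trunc_of_mem_domain K ⟨_, h⟩]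
        exact DFunLike.congr_fun (hH.trunc_comp_cutoff le_rfl) _
      rw [smul_apply, h4, ← map_smul]
      exact h3
    have h5 := hH.eq_truncExp_of_hasDerivAt hk t
    have h6 : X.cutoff K ((U 0 : E →L[ℂ] E) ψ) = ψ := by
      rw [hU.map_zero]
      exact X.cutoff_of_mem (X.space_le_upTo hMK hψ)
    rw [h6, hH.truncExp_eq_of_le hMK t (X.space_le_upTo le_rfl hψ)] at h5
    exact h5
  refine tendsto_nhds_unique (X.tendsto_cutoff _) (tendsto_const_nhds.congr' ?_)
  filter_upwards [eventually_ge_atTop M] with K h using (hK K h).symm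

end ExpGroup

end BlockControl

namespace BlockControl

open Filter Topology NormedSpace

variable {E : Type*} [NormedAddCommGroup E] [InnerProductSpace ℂ E] [CompleteSpace E]
  {X : ChargeSymmetry E}

/-! ### The one-parameter groups lie in `𝒮𝒰(X)` -/

section ExpMemSU

variable {H : E →ₗ.[ℂ] E}

theorem ChargeSymmetry.MemSU.exists_truncExp_comp_subtypeL (hH : X.MemSU H) (M : ℕ) (t : ℝ) :
    ∃ T : X.space M →L[ℂ] X.space M,
      hH.memU.truncExp M t ∘L (X.space M).subtypeL = (X.space M).subtypeL ∘L T ∧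
      LinearMap.det (T : X.space M →ₗ[ℂ] X.space M) = 1 := by
  have hs : IsSelfAdjoint (LinearMap.toContinuousLinearMap (X.block hH.memU M)) :=
    ContinuousLinearMap.isSelfAdjoint_iff_isSymmetric.2 (hH.memU.isSymmetric_block M)
  have hst := IsSelfAdjoint.smul (Complex.conj_ofReal t : IsSelfAdjoint (t : ℂ)) hs
  obtain ⟨T, hT, hdet⟩ := exists_exp_comp_eq_comp hst (L := (X.space M).subtypeL)
    (A := t • Complex.I • X.trunc hH.memU M) (ContinuousLinearMap.ext fun v => by
      change t • Complex.I • X.trunc hH.memU M v =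
        Complex.I • (t : ℂ) • (X.block hH.memU M v : E)
      rw [hH.memU.trunc_of_mem le_rfl v.2, hH.memU.coe_block_apply, smul_comm, Complex.coe_smul])
  refine ⟨T, hT, ?_⟩
  rw [hdet, ContinuousLinearMap.toLinearMap_smul, map_smul, LinearMap.coe_toContinuousLinearMap,
    hH.traceless]
  simp

theorem ChargeSymmetry.MemSU.mem_SU_of_isExpGroup (hH : X.MemSU H)
    {U : ℝ → unitary (E →L[ℂ] E)} (hU : IsExpGroup H U) (t : ℝ) : U t ∈ X.SU := by
  choose T hT hdet using fun M => hH.exists_truncExp_comp_subtypeL M t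
  have hUv : ∀ (M : ℕ) (v : X.space M), (U t : E →L[ℂ] E) v = T M v := by
    intro M v
    rw [hH.memU.eq_truncExp_of_isExpGroup hU v.2]
    exact DFunLike.congr_fun (hT M) v
  have hmem : ∀ (M : ℕ) (ψ : E), ψ ∈ X.space M → (U t : E →L[ℂ] E) ψ ∈ X.space M :=
    fun M ψ hψ => by rw [hUv M ⟨ψ, hψ⟩]; exact Subtype.mem _
  refine ⟨fun z => Subtype.ext (X.clm_ext fun M ψ hψ => ?_), fun μ => ?_⟩
  · change (X.rep z : E →L[ℂ] E) ((U t : E →L[ℂ] E) ψ) =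
      (U t : E →L[ℂ] E) ((X.rep z : E →L[ℂ] E) ψ)
    rw [hψ z, hmem M ψ hψ z, map_smul]
  · rcases lt_or_ge μ 0 with hμ | hμ
    · have : Subsingleton (X.space μ) :=
        (Submodule.subsingleton_iff_eq_bot).2 (X.space_eq_bot hμ)
      rw [Subsingleton.elim (compression (X.space μ) (U t : E →L[ℂ] E)) LinearMap.id,
        LinearMap.det_id]
    · obtain ⟨M, rfl⟩ := Int.eq_ofNat_of_zero_le hμ
      have hc : compression (X.space M) (U t : E →L[ℂ] E) =
          (T M : X.space M →ₗ[ℂ] X.space M) := by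
        ext v
        rw [coe_compression_apply_of_mem (hmem M v v.2), hUv]
        rfl
      rw [hc, hdet]

end ExpMemSU

/-! ### The dynamical group -/

section Dynamical

variable {d : ℕ} (H : Fin d → E →ₗ.[ℂ] E)

theorem isStronglyClosed_dynamicalGroup :
    IsStronglyClosed (dynamicalGroup H : Set (unitary (E →L[ℂ] E))) := by
  intro U hU
  refine Subgroup.mem_sInf.2 fun G hG => hG.1 U fun F ε hε => ?_
  obtain ⟨V, hV, h⟩ := hU F ε hε
  exact ⟨V, Subgroup.mem_sInf.1 hV G hG, h⟩

variable {H}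

theorem mem_dynamicalGroup {k : Fin d} {U : ℝ → unitary (E →L[ℂ] E)} (hU : IsExpGroup (H k) U)
    (t : ℝ) : U t ∈ dynamicalGroup H :=
  Subgroup.mem_sInf.2 fun _ hG => hG.2 k U hU t

theorem dynamicalGroup_le_SU (hH : ∀ k, X.MemSU (H k)) : dynamicalGroup H ≤ X.SUSubgroup :=
  sInf_le ⟨X.isStronglyClosed_SU, fun k _ hU t => (hH k).mem_SU_of_isExpGroup hU t⟩

end Dynamical

/-! ### Restricting a group of unitaries to finitely many charges -/

section Restriction

/-- The unitary `g` on the charges at most `K`, the identity on the others. -/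
noncomputable def ChargeSymmetry.restrictHom (X : ChargeSymmetry E)
    {G : Subgroup (unitary (E →L[ℂ] E))}
    (hG : G ≤ X.SUSubgroup) (K : ℕ) : G →* (E →L[ℂ] E) where
  toFun g := (g : unitary (E →L[ℂ] E)) * X.cutoff K + (1 - X.cutoff K)
  map_one' := by simp
  map_mul' g h := by
    have hcc : X.cutoff K * X.cutoff K = X.cutoff K :=
      ContinuousLinearMap.ext fun ψ => X.cutoff_of_mem (X.cutoff_mem K ψ)
    have hc : ∀ g : G, X.cutoff K * ((g : unitary (E →L[ℂ] E)) : E →L[ℂ] E) =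
        ((g : unitary (E →L[ℂ] E)) : E →L[ℂ] E) * X.cutoff K := fun g =>
      ContinuousLinearMap.ext fun ψ => X.cutoff_comm_of_comm (hG g.2).1 K ψ
    have h1 : X.cutoff K * (((h : unitary (E →L[ℂ] E)) : E →L[ℂ] E) * X.cutoff K) =
        ((h : unitary (E →L[ℂ] E)) : E →L[ℂ] E) * X.cutoff K := by
      rw [← mul_assoc, hc, mul_assoc, hcc]
    simp only [Subgroup.coe_mul, Submonoid.coe_mul, add_mul, mul_add, sub_mul, mul_sub, one_mul,
      mul_one, mul_assoc, hcc, h1]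
    abel

/-- The closed monoid of the restrictions of the elements of `G` to the charges at most `K`. -/
noncomputable def ChargeSymmetry.restrictMonoid (X : ChargeSymmetry E)
    {G : Subgroup (unitary (E →L[ℂ] E))}
    (hG : G ≤ X.SUSubgroup) (K : ℕ) : Submonoid (E →L[ℂ] E) :=
  (MonoidHom.mrange (X.restrictHom hG K)).topologicalClosure

/-- The crude bound 1 + 2 is enough: `lieOfMonoid` needs only some uniform bound. -/
theorem ChargeSymmetry.norm_le_of_mem_restrictMonoid {G : Subgroup (unitary (E →L[ℂ] E))}
    (hG : G ≤ X.SUSubgroup) (K : ℕ) {A : E →L[ℂ] E} (hA : A ∈ X.restrictMonoid hG K) :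
    ‖A‖ ≤ 3 := by
  have hcl : IsClosed {A : E →L[ℂ] E | ‖A‖ ≤ 3} := isClosed_le continuous_norm continuous_const
  refine closure_minimal ?_ hcl hA
  rintro _ ⟨g, rfl⟩
  refine ContinuousLinearMap.opNorm_le_bound _ (by norm_num) fun ψ => ?_
  change ‖((g : unitary (E →L[ℂ] E)) : E →L[ℂ] E) (X.cutoff K ψ) + (ψ - X.cutoff K ψ)‖ ≤ _
  have h1 := X.norm_cutoff_le K ψ
  refine (norm_add_le _ _).trans ?_
  rw [unitary_norm_map]
  linarith [norm_sub_le ψ (X.cutoff K ψ)]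

theorem ChargeSymmetry.restrictHom_apply_cutoff {G : Subgroup (unitary (E →L[ℂ] E))}
    (hG : G ≤ X.SUSubgroup) (K : ℕ) (g : G) (ψ : E) :
    X.restrictHom hG K g (X.cutoff K ψ) =
      ((g : unitary (E →L[ℂ] E)) : E →L[ℂ] E) (X.cutoff K ψ) := by
  change ((g : unitary (E →L[ℂ] E)) : E →L[ℂ] E) (X.cutoff K (X.cutoff K ψ)) +
    (X.cutoff K ψ - X.cutoff K (X.cutoff K ψ)) = _
  rw [X.cutoff_of_mem (X.cutoff_mem K ψ), sub_self, add_zero]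

theorem ChargeSymmetry.MemU.truncExp_mem_restrictMonoid {H : E →ₗ.[ℂ] E} (hH : X.MemU H)
    {U : ℝ → unitary (E →L[ℂ] E)} (hU : IsExpGroup H U) {G : Subgroup (unitary (E →L[ℂ] E))}
    (hG : G ≤ X.SUSubgroup) {t : ℝ} (hUG : U t ∈ G) (K : ℕ) :
    hH.truncExp K t ∈ X.restrictMonoid hG K := by
  refine subset_closure ⟨⟨U t, hUG⟩, ?_⟩
  ext ψ
  change (U t : E →L[ℂ] E) (X.cutoff K ψ) + (1 - X.cutoff K) ψ = _
  have h1 : (U t : E →L[ℂ] E) (X.cutoff K ψ) = hH.truncExp K t (X.cutoff K ψ) := by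
    refine X.eqOn_upTo (fun μ hμ φ hφ => ?_) (X.cutoff_mem K ψ)
    rw [hH.eq_truncExp_of_isExpGroup hU hφ,
      hH.truncExp_eq_of_le hμ t (X.space_le_upTo le_rfl hφ)]
  have h2 : hH.truncExp K t ((1 - X.cutoff K) ψ) = (1 - X.cutoff K) ψ :=
    DFunLike.congr_fun (hH.truncExp_comp_one_sub_cutoff K t) ψ
  rw [h1, ← h2, ← map_add]
  congr 1
  simp

/-- The generators belong to `lieOfMonoid` of the closed restriction monoid, hence so does the Lie
algebra they span; take t = 1. -/
theorem ChargeSymmetry.exp_mem_restrictMonoid {d : ℕ} {H : Fin d → E →ₗ.[ℂ] E}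
    (hH : ∀ k, X.MemSU (H k)) {K : ℕ} {Q : E →L[ℂ] E}
    (hQ : Q ∈ X.truncLie (fun k => (hH k).memU) K) :
    exp Q ∈ X.restrictMonoid (dynamicalGroup_le_SU hH) K := by
  have hle : X.truncLie (fun k => (hH k).memU) K ≤
      lieOfMonoid (X.restrictMonoid (dynamicalGroup_le_SU hH) K)
        (Submonoid.isClosed_topologicalClosure _) 3
        (fun _ hA => X.norm_le_of_mem_restrictMonoid _ K hA) := by
    refine LieSubalgebra.lieSpan_le.2 ?_
    rintro _ ⟨k, rfl⟩
    obtain ⟨U, hU⟩ := (hH k).memU.exists_isExpGroup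
    exact fun t => (hH k).memU.truncExp_mem_restrictMonoid hU _ (mem_dynamicalGroup hU t) K
  simpa using hle hQ 1

end Restriction

/-! ### Surjectivity of the exponential on finitely many charges -/

section Surjective

variable {V : Submodule ℂ E} [FiniteDimensional ℂ V]

/-- The compression of U to a reducing subspace is unitary and has a traceless logarithm. Allowing
any A that restricts to D on V lets the logarithms of several blocks be summed. -/
theorem exists_mem_suSubspace_exp_eq {U : unitary (E →L[ℂ] E)}
    (hV : ∀ ψ ∈ V, (U : E →L[ℂ] E) ψ ∈ V)
    (hV' : ∀ ψ ∈ V, (star (U : E →L[ℂ] E)) ψ ∈ V)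
    (hdet : LinearMap.det (compression V (U : E →L[ℂ] E)) = 1) :
    ∃ D : V →L[ℂ] V, V.subtypeL ∘L D ∘L V.orthogonalProjectionOnto ∈ suSubspace V ∧
      ∀ A : E →L[ℂ] E, A ∘L V.subtypeL = V.subtypeL ∘L D →
        ∀ v : V, exp A v = (U : E →L[ℂ] E) v := by
  let c : (E →L[ℂ] E) → V →L[ℂ] V := fun A => V.orthogonalProjectionOnto ∘L A ∘L V.subtypeL
  have hc : ∀ (A : E →L[ℂ] E) (v : V), A v ∈ V → (c A v : E) = A v := fun A v h =>
    coe_compression_apply_of_mem h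
  have hstar : star (c U) = c (star (U : E →L[ℂ] E)) := by
    symm
    refine (ContinuousLinearMap.eq_adjoint_iff _ _).2 fun v w => ?_
    rw [Submodule.coe_inner, Submodule.coe_inner, hc _ _ (hV' v v.2), hc _ _ (hV w w.2)]
    exact ContinuousLinearMap.adjoint_inner_left _ _ _
  have hcU : c U ∈ unitary (V →L[ℂ] V) := by
    rw [Unitary.mem_iff, hstar]
    constructor
    · ext v
      rw [mul_apply_eq_comp, hc _ _ (hV' _ (Subtype.mem _)), hc _ _ (hV v v.2)]
      exact DFunLike.congr_fun (Unitary.star_mul_self_of_mem U.2) (v : E)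
    · ext v
      rw [mul_apply_eq_comp, hc _ _ (hV _ (Subtype.mem _)), hc _ _ (hV' v v.2)]
      exact DFunLike.congr_fun (Unitary.mul_star_self_of_mem U.2) (v : E)
  obtain ⟨C, hC, htr, hexp⟩ := exists_traceless_exp_comp_eq (E := E) hcU hdet
  refine ⟨Complex.I • C, ⟨?_, ?_, ?_, ?_⟩, fun A hA v => by
    rw [← hc _ _ (hV v v.2)]; exact DFunLike.congr_fun (hexp A _ hA) v⟩
  · rw [ContinuousLinearMap.star_eq_adjoint]
    symm
    rw [ContinuousLinearMap.eq_adjoint_iff]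
    intro x y
    have hs := ContinuousLinearMap.isSelfAdjoint_iff_isSymmetric.1 hC
      (V.orthogonalProjectionOnto x) (V.orthogonalProjectionOnto y)
    simp only [ContinuousLinearMap.coe_coe] at hs
    simp only [neg_apply, ContinuousLinearMap.comp_apply, smul_apply, Submodule.subtypeL_apply,
      Submodule.coe_smul, inner_neg_left, inner_smul_left, inner_smul_right, Complex.conj_I,
      neg_mul, neg_neg]
    rw [← Submodule.inner_orthogonalProjectionOnto_eq_of_mem_left,
      ← Submodule.inner_orthogonalProjectionOnto_eq_of_mem_right, hs]
  · ext x
    exact Submodule.starProjection_eq_self_iff.2 (Subtype.mem _)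
  · ext x
    simp only [ContinuousLinearMap.comp_apply]
    congr 2
    exact Submodule.orthogonalProjectionOnto_mem_subspace_eq_self _
  · have : compression V (V.subtypeL ∘L (Complex.I • C) ∘L V.orthogonalProjectionOnto) =
        Complex.I • (C : V →ₗ[ℂ] V) := by
      ext v
      rw [coe_compression_apply_of_mem (Subtype.mem _)]
      simp only [ContinuousLinearMap.comp_apply,
        Submodule.orthogonalProjectionOnto_mem_subspace_eq_self]
      rfl
    rw [this, map_smul, htr, smul_zero]

theorem ChargeSymmetry.exists_mem_suTrunc_exp_eq {U : unitary (E →L[ℂ] E)} (hU : U ∈ X.SU)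
    (K : ℕ) : ∃ Q ∈ X.suTrunc K, ∀ ψ ∈ X.upTo K, exp Q ψ = (U : E →L[ℂ] E) ψ := by
  have hex := fun μ : ℕ => exists_mem_suSubspace_exp_eq
    (fun _ hψ => X.map_space_of_comm hU.1 (μ : ℤ) hψ)
    (fun _ hψ => X.map_space_of_comm (X.comm_star hU.1) (μ : ℤ) hψ) (hU.2 μ)
  choose D hD hDU using hex
  refine ⟨_, ⟨fun μ => (X.space μ).subtypeL ∘L D μ ∘L (X.space μ).orthogonalProjectionOnto,
    fun μ _ => hD μ, rfl⟩, fun ψ hψ => X.eqOn_upTo (fun μ hμ φ hφ => ?_) hψ⟩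
  refine hDU μ _ ?_ ⟨φ, hφ⟩
  ext v
  rw [ContinuousLinearMap.comp_apply, sum_apply, Finset.sum_eq_single_of_mem μ
    (Finset.mem_range.2 (Nat.lt_succ_of_le hμ))]
  · simp [Submodule.orthogonalProjectionOnto_mem_subspace_eq_self]
  · intro ν _ hν
    have : (X.space ν).orthogonalProjectionOnto (v : E) = 0 :=
      Subtype.ext (X.proj_of_mem_of_ne (by exact_mod_cast hν) v.2)
    simp [this]

end Surjective

/-! ### Strong approximation and the final equality -/

theorem SU_subset_dynamicalGroup {d : ℕ} {H : Fin d → E →ₗ.[ℂ] E} (hH : ∀ k, X.MemSU (H k))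
    (hK : ∀ K : ℕ, 1 ≤ K →
      X.suTrunc K ⊆ (X.truncLie (fun k => (hH k).memU) K : Set (E →L[ℂ] E))) :
    X.SU ⊆ (dynamicalGroup H : Set (unitary (E →L[ℂ] E))) := by
  intro U hU
  refine isStronglyClosed_dynamicalGroup H U fun F ε hε => ?_
  obtain ⟨K, hK1, hKF⟩ : ∃ K : ℕ, 1 ≤ K ∧ ∀ ψ ∈ F, ‖ψ - X.cutoff K ψ‖ < ε / 3 := by
    have h1 : ∀ᶠ K in atTop, ∀ ψ ∈ F, ‖ψ - X.cutoff K ψ‖ < ε / 3 := by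
      refine (Finset.eventually_all F).2 fun ψ _ => ?_
      filter_upwards [Metric.tendsto_nhds.1 (X.tendsto_cutoff ψ) (ε / 3) (by positivity)] with K h
      rwa [← dist_eq_norm, dist_comm]
    exact ((eventually_ge_atTop 1).and h1).exists
  obtain ⟨Q, hQ, hQU⟩ := X.exists_mem_suTrunc_exp_eq hU K
  have hmem := X.exp_mem_restrictMonoid hH (hK K hK1 hQ)
  -- A positive bound for all test vectors, even when F is empty. Norm accuracy ε / (3 * R) costs ε
  -- / 3 on the cut-off part; the tails under g and U cost ε / 3 each.
  set R : ℝ := 1 + ∑ ψ ∈ F, ‖ψ‖ with hR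
  have hRpos : 0 < R := by positivity
  obtain ⟨_, ⟨g, rfl⟩, hg⟩ := Metric.mem_closure_iff.1 hmem (ε / (3 * R)) (by positivity)
  refine ⟨g, g.2, fun ψ hψ => ?_⟩
  have hψR : ‖ψ‖ ≤ R := by
    have := Finset.single_le_sum (f := fun ψ : E => ‖ψ‖) (fun _ _ => norm_nonneg _) hψ
    linarith
  have h1 : ((g : unitary (E →L[ℂ] E)) : E →L[ℂ] E) (X.cutoff K ψ) -
      (U : E →L[ℂ] E) (X.cutoff K ψ) =
      (X.restrictHom (dynamicalGroup_le_SU hH) K g - exp Q) (X.cutoff K ψ) := by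
    rw [sub_apply, X.restrictHom_apply_cutoff, hQU _ (X.cutoff_mem K ψ)]
  have h2 : ‖(X.restrictHom (dynamicalGroup_le_SU hH) K g - exp Q) (X.cutoff K ψ)‖ ≤ ε / 3 := by
    refine (ContinuousLinearMap.le_opNorm _ _).trans ?_
    rw [dist_comm, dist_eq_norm] at hg
    calc _ ≤ ε / (3 * R) * R := mul_le_mul hg.le ((X.norm_cutoff_le K ψ).trans hψR)
          (norm_nonneg _) (by positivity)
      _ = ε / 3 := by field_simp
  have h3 : (((g : unitary (E →L[ℂ] E)) : E →L[ℂ] E) - (U : E →L[ℂ] E)) ψ =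
      ((g : unitary (E →L[ℂ] E)) : E →L[ℂ] E) (ψ - X.cutoff K ψ) -
        (U : E →L[ℂ] E) (ψ - X.cutoff K ψ) +
      (((g : unitary (E →L[ℂ] E)) : E →L[ℂ] E) (X.cutoff K ψ) -
        (U : E →L[ℂ] E) (X.cutoff K ψ)) := by
    rw [sub_apply, map_sub, map_sub]; abel
  rw [h3, h1]
  refine (norm_add_le _ _).trans_lt ?_
  have h4 := norm_sub_le (((g : unitary (E →L[ℂ] E)) : E →L[ℂ] E) (ψ - X.cutoff K ψ))
    ((U : E →L[ℂ] E) (ψ - X.cutoff K ψ))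
  rw [unitary_norm_map, unitary_norm_map] at h4
  linarith [hKF ψ hψ]

end BlockControl

theorem mainTheorem11 {E : Type*} [NormedAddCommGroup E] [InnerProductSpace ℂ E]
    [CompleteSpace E] (X : BlockControl.ChargeSymmetry E) (d : ℕ) (H : Fin d → E →ₗ.[ℂ] E)
    (hH : ∀ k, X.MemSU (H k))
    (hK : ∀ K : ℕ, 1 ≤ K →
      (X.truncLie (fun k => (hH k).memU) K : Set (E →L[ℂ] E)) = X.suTrunc K) :
    (BlockControl.dynamicalGroup H : Set (unitary (E →L[ℂ] E))) = X.SU :=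
  Set.Subset.antisymm (BlockControl.dynamicalGroup_le_SU hH)
    (BlockControl.SU_subset_dynamicalGroup hH fun K h => (hK K h).ge)
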